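/- Setup. Let $N$ and $k_1,\dots,k_N$ be given, $k=\sum_i k_i$, $m=k+N$. On a probability space let $x_t=(x_{1,t}',\dots,x_{N,t}')'\in\mathbb R^{k}$, with $x_{i,t}\in\mathbb R^{k_i}$, and $u_t\in\mathbb R^N$, $t\in\mathbb Z$, be random vectors with $\mathbb E[x_t]=\mu_x$ and $\mathbb E[u_t]=0$, and let $$y_{i,t}=\alpha_i+x_{i,t}'\beta_i+u_{i,t},\qquad i=1,\dots,N .$$ Put $\bar z_t=((x_t-\mu_x)',u_t')'\in\mathbb R^m$. Let $\mathscr H_t$ be the closed linear span in $L^2$ of all components of $\bar z_s$, $s\le t$; let $\mathscr P_{t-1}$ be the $L^2$-orthogonal projection onto $\mathscr H_{t-1}$ and $\mathscr P^{(p)}_{t-1}$ the one onto the span of the components of $\bar z_{t-1},\dots,\bar z_{t-p}$, both applied component by component. Let $\varepsilon_t=(\varepsilon_{x,t}',\varepsilon_{u,t}')'=\bar z_t-\mathscr P_{t-1}[\bar z_t]$. Assumption 1. The process $\{\bar z_t\}$ is covariance-stationary with finite second moments and purely nondeterministic ($\bigcap_t\mathscr H_t=\{0\}$), and for the fixed $p_0\ge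 1$ one has $\mathscr P_{t-1}[\bar z_t]=\mathscr P^{(p_0)}_{t-1}[\bar z_t]$ for all $t$. The innovations $\{\varepsilon_t\}$ are strongly mixing and for some $\delta>0$ their mixing coefficients $$\alpha_\varepsilon(\ell)=\sup_t\ \sup\{|\mathbb P(A\cap B)-\mathbb P(A)\mathbb P(B)|: A\in\sigma(\varepsilon_s,s\le t-\ell),\ B\in\sigma(\varepsilon_s,s\ge t)\}$$ satisfy $\sum_{\ell\ge1}\alpha_\varepsilon(\ell)^{\delta/(2+\delta)}<\infty$, while $\sup_t\mathbb E\|\varepsilon_t\|^{4+2\delta}<\infty$. The matrix $\Sigma=\mathbb E[\varepsilon_t\varepsilon_t']$ is positive definite. Assumption 2. With $X_t=\mathrm{blkdiag}(x_{1,t},\dots,x_{N,t})\in\mathbb R^{k\times N}$ and $Z_t'=[I_N,X_t']$, the matrix $\mathbb E[Z_tZ_t']$ is positive definite. Lemma. Suppose Assumptions 1 and 2 hold. Then there are unique matrices $\Psi_1,\dots,\Psi_{p_0}\in\mathbb R^{m\times m}$ with $\bar z_t=\sum_{j=1}^{p_0}\Psi_j\bar z_{t-j}+\varepsilon_t$ almost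 surely for all $t$. Write $$\Psi_j=\begin{bmatrix}\Psi_{xx,j}&\Psi_{xu,j}\\ \Psi_{ux,j}&\Psi_{uu,j}\end{bmatrix},\qquad \Sigma=\begin{bmatrix}\Sigma_{xx}&\Sigma_{xu}\\ \Sigma_{ux}&\Sigma_{uu}\end{bmatrix}$$ for their blocks. Assume that one of the following conditions holds: (BD) $\Psi_{xu,j}=0$ and $\Psi_{ux,j}=0$ for all $j$, and $\Sigma_{xu}=0$; (GEXOG) $\Psi_{ux,j}=0$ for all $j$, and $\Sigma_{xu}=0$; (EBD) $\Sigma_{xu}=0$. For each $i$ let $$w_{i,t}=(1,x_{i,t}',y_{t-1}',\dots,y_{t-p_0}',x_{t-1}',\dots,x_{t-p_0}')',\qquad \theta_i=(\gamma_i,\beta_i',\psi_{uu,1,i}',\dots,\psi_{uu,p_0,i}',\lambda_{1,i}',\dots,\lambda_{p_0,i}')',$$ where $\gamma=(I_N-\sum_j\Psi_{uu,j})\alpha-\sum_j\Psi_{ux,j}\mu_x$, where $\psi_{uu,j,i}'$ and $\lambda_{j,i}'$ are the $i$-th rows of $\Psi_{uu,j}$ and of $\Lambda_j=\Psi_{ux,j}-\Psi_{uu,j}B$,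 and $B=\mathrm{blkdiag}(\beta_1',\dots,\beta_N')$. Let $$\widehat\theta_i^{\mathrm D}=\Bigl(\frac1{T-p_0}\sum_{t=p_0+1}^Tw_{i,t}w_{i,t}'\Bigr)^{-1}\Bigl(\frac1{T-p_0}\sum_{t=p_0+1}^Tw_{i,t}y_{i,t}\Bigr)$$ be the equation-by-equation OLS estimator. Then, for each $i=1,\dots,N$, as $T\to\infty$ with $p_0$ fixed, the matrix inverted here is nonsingular with probability tending to one, and $\widehat\theta_i^{\mathrm D}\xrightarrow{p}\theta_i$. -/

import Mathlib

open MeasureTheory Filter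
open scoped NNReal ENNReal Topology

noncomputable section

namespace Durbin

/-! ### Second-order theory of a vector process on `ℤ` -/

section Series

variable {Ω : Type*} [MeasurableSpace Ω] {ι : Type*}

/-- The class in `L²` of a square-integrable random variable (and `0` if it is not one). -/
def toL2 (μ : Measure Ω) (f : Ω → ℝ) : Lp ℝ 2 μ :=
  open Classical in if h : MemLp f 2 μ then h.toLp f else 0

/-- The closed linear span in `L²` of all the components of `Z s`, for the times `s ∈ S`.
(For finite `S` and finitely many components the span is finite dimensional, so it is already
closed.) Finite linear combinations of components are the same as the components of finite
combinations of the vectors `Z s` with matrix coefficients. -/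
def linSpace (μ : Measure Ω) (Z : ℤ → Ω → ι → ℝ) (S : Set ℤ) : Submodule ℝ (Lp ℝ 2 μ) :=
  (Submodule.span ℝ {f | ∃ s ∈ S, ∃ a : ι, f = toL2 μ (fun ω => Z s ω a)}).topologicalClosure

/-- The `L²`-orthogonal projection of the component `a` of `Z t` onto the closed linear span of
the components of `Z s`, `s ∈ S`. -/
def linPred (μ : Measure Ω) (Z : ℤ → Ω → ι → ℝ) (S : Set ℤ) (t : ℤ) (a : ι) : Lp ℝ 2 μ :=
  haveI : CompleteSpace (linSpace μ Z S) :=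
    (Submodule.isClosed_topologicalClosure _).completeSpace_coe
  (linSpace μ Z S).starProjection (toL2 μ (fun ω => Z t ω a))

/-- The one-step-ahead linear innovation of `Z` at time `t`: component by component, `Z t` minus
its projection onto the closed linear span of the whole past `Z (t-1), Z (t-2), …`. -/
def innov (μ : Measure Ω) (Z : ℤ → Ω → ι → ℝ) (t : ℤ) (ω : Ω) (a : ι) : ℝ :=
  (toL2 μ (fun ω => Z t ω a) - linPred μ Z (Set.Iic (t - 1)) t a : Lp ℝ 2 μ) ω

/-- The innovation covariance matrix `E[ε_t ε_t']`. -/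
def innovCov (μ : Measure Ω) (Z : ℤ → Ω → ι → ℝ) (t : ℤ) : Matrix ι ι ℝ :=
  Matrix.of fun a b => ∫ ω, innov μ Z t ω a * innov μ Z t ω b ∂μ

/-- `Z` has finite second moments, a constant mean and autocovariances that depend only on the
lag. -/
structure CovStationary (μ : Measure Ω) (Z : ℤ → Ω → ι → ℝ) : Prop where
  memLp : ∀ t a, MemLp (fun ω => Z t ω a) 2 μ
  mean : ∀ s t a, ∫ ω, Z s ω a ∂μ = ∫ ω, Z t ω a ∂μ
  cov : ∀ s t h a b,
    ProbabilityTheory.covariance (fun ω => Z s ω a) (fun ω => Z (s - h) ω b) μ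
      = ProbabilityTheory.covariance (fun ω => Z t ω a) (fun ω => Z (t - h) ω b) μ

/-- The remote linear past of `Z` is trivial. -/
def PurelyNondeterministic (μ : Measure Ω) (Z : ℤ → Ω → ι → ℝ) : Prop :=
  ⨅ n : ℤ, linSpace μ Z (Set.Iic n) = ⊥

/-- The best linear predictor from the whole past only uses the last `p` vectors. -/
def FinitePredictor (μ : Measure Ω) (Z : ℤ → Ω → ι → ℝ) (p : ℕ) : Prop :=
  ∀ t a, linPred μ Z (Set.Iic (t - 1)) t a = linPred μ Z (Set.Icc (t - p) (t - 1)) t a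

/-- The σ-algebra generated by `V s`, `s ∈ S`. -/
abbrev sigmaOf (V : ℤ → Ω → ι → ℝ) (S : Set ℤ) : MeasurableSpace Ω :=
  ⨆ s ∈ S, MeasurableSpace.comap (V s) inferInstance

/-- The strong mixing coefficient `α(ℓ)`: the supremum over `t`, over `A` in the σ-algebra of
`V s`, `s ≤ t - ℓ`, and over `B` in the σ-algebra of `V s`, `s ≥ t`, of
`|P(A ∩ B) - P(A) P(B)|`. -/
def alphaMix (μ : Measure Ω) (V : ℤ → Ω → ι → ℝ) (l : ℕ) : ℝ :=
  sSup {r | ∃ (t : ℤ) (A B : Set Ω), MeasurableSet[sigmaOf V (Set.Iic (t - l))] A ∧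
    MeasurableSet[sigmaOf V (Set.Ici t)] B ∧ r = |μ.real (A ∩ B) - μ.real A * μ.real B|}

/-- Finite-predictor exactness at lag `p`, together with mixing, moments and nondegeneracy of the
innovations. The moments are bounded uniformly in time. -/
structure Assumption1 [Fintype ι] (μ : Measure Ω) (Z : ℤ → Ω → ι → ℝ) (p : ℕ) : Prop where
  covStationary : CovStationary μ Z
  purelyNondet : PurelyNondeterministic μ Z
  one_le : 1 ≤ p
  finitePredictor : FinitePredictor μ Z p
  mixing : ∃ δ : ℝ, 0 < δ ∧
    Tendsto (fun l : ℕ => alphaMix μ (innov μ Z) l) atTop (𝓝 0) ∧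
    Summable (fun l : ℕ => alphaMix μ (innov μ Z) (l + 1) ^ (δ / (2 + δ))) ∧
    ∃ C : ℝ≥0, ∀ t, ∫⁻ ω, ‖innov μ Z t ω‖ₑ ^ (4 + 2 * δ) ∂μ ≤ C
  posDef : ∀ t, (innovCov μ Z t).PosDef

/-- `Z` satisfies the vector autoregression `Z_t = ∑_{j=1}^p Ψ_j Z_{t-j} + ε_t` driven by its own
innovations (`Ψ j` is the coefficient of lag `j + 1`, for `j = 0, …, p - 1`). -/
def IsVAR [Fintype ι] (μ : Measure Ω) (Z : ℤ → Ω → ι → ℝ) (p : ℕ)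
    (Ψ : Fin p → Matrix ι ι ℝ) : Prop :=
  ∀ t : ℤ, ∀ᵐ ω ∂μ, Z t ω = ∑ j : Fin p, (Ψ j).mulVec (Z (t - (j + 1)) ω) + innov μ Z t ω

end Series

/-! ### The regression system -/

section Model

variable {Ω : Type*} [MeasurableSpace Ω] {N : ℕ} {k : Fin N → ℕ}

/-- Positions in the stacked regressor vector `x_t = (x_{1,t}', …, x_{N,t}')'`. -/
abbrev XIdx (k : Fin N → ℕ) : Type := Σ i : Fin N, Fin (k i)

/-- Positions in `z_t = (x_t', u_t')'`. -/
abbrev ZIdx (k : Fin N → ℕ) : Type := XIdx k ⊕ Fin N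

/-- The centred joint process `(x_t - μ_x, u_t)`. -/
def zbar (μx : XIdx k → ℝ) (x : ℤ → Ω → XIdx k → ℝ) (u : ℤ → Ω → Fin N → ℝ)
    (t : ℤ) (ω : Ω) : ZIdx k → ℝ :=
  Sum.elim (x t ω - μx) (u t ω)

/-- The dependent variables `y_{i,t} = α_i + x_{i,t}' β_i + u_{i,t}`. -/
def yProc (α : Fin N → ℝ) (β : XIdx k → ℝ) (x : ℤ → Ω → XIdx k → ℝ) (u : ℤ → Ω → Fin N → ℝ)
    (t : ℤ) (ω : Ω) (i : Fin N) : ℝ :=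
  α i + ∑ a : Fin (k i), x t ω ⟨i, a⟩ * β ⟨i, a⟩ + u t ω i

/-- The block-diagonal regressor matrix with the blocks `x_{1,t}, …, x_{N,t}`. -/
def XMat (x : ℤ → Ω → XIdx k → ℝ) (t : ℤ) (ω : Ω) : Matrix (XIdx k) (Fin N) ℝ :=
  Matrix.of fun a i => if a.1 = i then x t ω a else 0

/-- `Z_t`, the transpose of `[I_N, X_t']`. -/
def ZMat (x : ℤ → Ω → XIdx k → ℝ) (t : ℤ) (ω : Ω) : Matrix (Fin N ⊕ XIdx k) (Fin N) ℝ :=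
  Matrix.fromRows 1 (XMat x t ω)

/-- `E[Z_t Z_t']` is positive definite. -/
def Assumption2 (μ : Measure Ω) (x : ℤ → Ω → XIdx k → ℝ) : Prop :=
  ∀ t, (Matrix.of fun a b => ∫ ω, (ZMat x t ω * (ZMat x t ω).transpose) a b ∂μ).PosDef

/-- Error-block-diagonality: `Σ_xu = 0`; the coefficients `Ψ_j` are unrestricted. -/
def EBD (μ : Measure Ω) (Z : ℤ → Ω → ZIdx k → ℝ) : Prop :=
  ∀ t, (innovCov μ Z t).toBlocks₁₂ = 0

/-- GLS-exogeneity: `Ψ_{ux,j} = 0` for all `j`, and `Σ_xu = 0`. -/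
def GEXOG (μ : Measure Ω) (Z : ℤ → Ω → ZIdx k → ℝ) {p : ℕ}
    (Ψ : Fin p → Matrix (ZIdx k) (ZIdx k) ℝ) : Prop :=
  (∀ j, (Ψ j).toBlocks₂₁ = 0) ∧ ∀ t, (innovCov μ Z t).toBlocks₁₂ = 0

/-- Block-diagonality: `Ψ_{xu,j} = 0` and `Ψ_{ux,j} = 0` for all `j`, and `Σ_xu = 0`. -/
def BD (μ : Measure Ω) (Z : ℤ → Ω → ZIdx k → ℝ) {p : ℕ}
    (Ψ : Fin p → Matrix (ZIdx k) (ZIdx k) ℝ) : Prop :=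
  (∀ j, (Ψ j).toBlocks₁₂ = 0) ∧ (∀ j, (Ψ j).toBlocks₂₁ = 0) ∧
    ∀ t, (innovCov μ Z t).toBlocks₁₂ = 0

/-- Positions in the regressor vector of equation `i` of the augmented regression: the constant,
`x_{i,t}`, the `p` lags of `y_t`, the `p` lags of `x_t`. -/
abbrev WIdx (k : Fin N → ℕ) (p : ℕ) (i : Fin N) : Type :=
  Unit ⊕ Fin (k i) ⊕ (Fin p × Fin N) ⊕ (Fin p × XIdx k)

/-- The regressor vector
`w_{i,t} = (1, x_{i,t}', y_{t-1}', …, y_{t-p}', x_{t-1}', …, x_{t-p}')'`. -/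
def wVec (p : ℕ) (y : ℤ → Ω → Fin N → ℝ) (x : ℤ → Ω → XIdx k → ℝ) (i : Fin N)
    (t : ℤ) (ω : Ω) : WIdx k p i → ℝ :=
  Sum.elim (fun _ => 1) <| Sum.elim (fun a => x t ω ⟨i, a⟩) <|
    Sum.elim (fun jl => y (t - (jl.1 + 1)) ω jl.2) (fun ja => x (t - (ja.1 + 1)) ω ja.2)

/-- `B = blkdiag(β_1', …, β_N')`. -/
def BMat (β : XIdx k → ℝ) : Matrix (Fin N) (XIdx k) ℝ :=
  Matrix.of fun i a => if a.1 = i then β a else 0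

/-- The intercept `γ = (I - ∑_j Ψ_{uu,j}) α - ∑_j Ψ_{ux,j} μ_x`. -/
def gammaVec {p : ℕ} (α : Fin N → ℝ) (μx : XIdx k → ℝ)
    (Ψ : Fin p → Matrix (ZIdx k) (ZIdx k) ℝ) : Fin N → ℝ :=
  (1 - ∑ j, (Ψ j).toBlocks₂₂).mulVec α - (∑ j, (Ψ j).toBlocks₂₁).mulVec μx

/-- `Λ_j = Ψ_{ux,j} - Ψ_{uu,j} B`. -/
def LambdaMat {p : ℕ} (β : XIdx k → ℝ) (Ψ : Fin p → Matrix (ZIdx k) (ZIdx k) ℝ) (j : Fin p) :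
    Matrix (Fin N) (XIdx k) ℝ :=
  (Ψ j).toBlocks₂₁ - (Ψ j).toBlocks₂₂ * BMat β

/-- The parameter `θ_i = (γ_i, β_i', ψ_{uu,1,i}', …, ψ_{uu,p,i}', λ_{1,i}', …, λ_{p,i}')'`, where
`ψ_{uu,j,i}'` and `λ_{j,i}'` are the `i`-th rows of `Ψ_{uu,j}` and `Λ_j`. -/
def thetaVec {p : ℕ} (α : Fin N → ℝ) (β : XIdx k → ℝ) (μx : XIdx k → ℝ)
    (Ψ : Fin p → Matrix (ZIdx k) (ZIdx k) ℝ) (i : Fin N) : WIdx k p i → ℝ :=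
  Sum.elim (fun _ => gammaVec α μx Ψ i) <| Sum.elim (fun a => β ⟨i, a⟩) <|
    Sum.elim (fun jl => (Ψ jl.1).toBlocks₂₂ i jl.2) (fun ja => LambdaMat β Ψ ja.1 i ja.2)

/-- The sample second-moment matrix `(T - p)⁻¹ ∑_{t=p+1}^T w_{i,t} w_{i,t}'`. -/
def sampleGram (p : ℕ) (y : ℤ → Ω → Fin N → ℝ) (x : ℤ → Ω → XIdx k → ℝ) (i : Fin N)
    (T : ℕ) (ω : Ω) : Matrix (WIdx k p i) (WIdx k p i) ℝ :=
  ((T : ℝ) - p)⁻¹ • ∑ t ∈ Finset.Icc (p + 1) T,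
    Matrix.vecMulVec (wVec p y x i t ω) (wVec p y x i t ω)

/-- The equation-by-equation Durbin (OLS) estimator of `θ_i` on the sample `t = p+1, …, T`. -/
def thetaHat (p : ℕ) (y : ℤ → Ω → Fin N → ℝ) (x : ℤ → Ω → XIdx k → ℝ) (i : Fin N)
    (T : ℕ) (ω : Ω) : WIdx k p i → ℝ :=
  (sampleGram p y x i T ω)⁻¹.mulVec
    (((T : ℝ) - p)⁻¹ • ∑ t ∈ Finset.Icc (p + 1) T, y t ω i • wVec p y x i t ω)

end Model

end Durbin

end

open MeasureTheory Filter
open scoped NNReal ENNReal Topology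

noncomputable section

namespace Durbin

/-! ### Averages in normed spaces -/

section Average

variable {F : Type*} [NormedAddCommGroup F] [NormedSpace ℝ F]

/-! Everything takes place in the Hilbert space `Lp ℝ 2 μ`, which contains the components of the
centred process and the constant `oneL2`.

Existence of the `Ψ_j`: finite-predictor exactness gives coefficients at each time, and by
stationarity the normal equations are the same at all times, so the coefficients found at time `0`
serve everywhere (`exists_var_coeff`). Uniqueness: a positive definite `Σ` makes the lags linearly
independent (`eq_zero_of_sum_lags_eq_zero`).

Substituting `u = y - α - Bx` for the lagged errors in the `u`-rows of the autoregression yields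
`y_{i,t} = w_{i,t}'θ_i + ε_{u,i,t}` (`regY_eq`). Least squares is then consistent for three reasons,
combined in `leastSquares_consistent`. The regressors are linearly independent, so the limiting Gram
matrix is invertible (`linearIndependent_regW`). The error is orthogonal to them: to the lags
because it is an innovation, to `x_{i,t}` because `Σ_xu = 0` under each of the three conditions
(`inner_innovation_regW`). And sample second moments obey a law of large numbers
(`ProductLLN.of_mem_lagsWithConst`).

The last point is the long one, since mixing is assumed of the innovations and not of the process.
Products of lagged innovations depend on a finite window of a mixing sequence and have bounded
second moments, so truncation and a covariance inequality give the law in `L¹`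
(`tendsto_average_of_mixing`). To pass to the process, iterate the autoregression `n` times: the
remainder is a projection onto the remote past, which vanishes in the limit by pure nondeterminism,
and by stationarity its norm does not depend on time. Hence finite moving averages approximate
uniformly in time (`exists_moving_average_approx`), and the centred product is continuous from `L² ×
L²` to `L¹`. -/

/-- The average of `h` over the `n` integers starting at `c`. -/
def average (c : ℤ) (h : ℤ → F) (n : ℕ) : F :=
  (n : ℝ)⁻¹ • ∑ i ∈ Finset.range n, h (c + i)

lemma average_add (c : ℤ) (g h : ℤ → F) (n : ℕ) :
    average c (g + h) n = average c g n + average c h n := by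
  simp [average, Finset.sum_add_distrib]

lemma average_smul (c : ℤ) (r : ℝ) (h : ℤ → F) (n : ℕ) :
    average c (r • h) n = r • average c h n := by
  simp only [average, Pi.smul_apply, ← Finset.smul_sum]
  rw [smul_comm]

lemma average_map {G : Type*} [NormedAddCommGroup G] [NormedSpace ℝ G] (L : F →L[ℝ] G) (c : ℤ)
    (h : ℤ → F) (n : ℕ) : average c (fun t => L (h t)) n = L (average c h n) := by
  simp [average, map_sum]

lemma norm_average_le (c : ℤ) (h : ℤ → F) (n : ℕ) {r : ℝ} (hr : 0 ≤ r) (hh : ∀ t, ‖h t‖ ≤ r) :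
    ‖average c h n‖ ≤ r := by
  rcases Nat.eq_zero_or_pos n with rfl | hn
  · simpa [average] using hr
  have hn' : (0 : ℝ) < n := by exact_mod_cast hn
  have h1 : ‖∑ i ∈ Finset.range n, h (c + i)‖ ≤ n * r := by
    refine (norm_sum_le_of_le (Finset.range n) (fun i _ => hh (c + (i : ℤ)))).trans ?_
    simp
  rw [average, norm_smul, norm_inv, Real.norm_of_nonneg hn'.le, inv_mul_le_iff₀ hn']
  exact h1

/-- Null averages are stable under uniform approximation. -/
lemma tendsto_average_of_approx (c : ℤ) (h : ℤ → F)
    (H : ∀ ε > 0, ∃ g : ℤ → F, (∀ t, ‖h t - g t‖ ≤ ε) ∧ Tendsto (average c g) atTop (𝓝 0)) :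
    Tendsto (average c h) atTop (𝓝 0) := by
  rw [Metric.tendsto_atTop]
  intro ε hε
  obtain ⟨g, hg, hlim⟩ := H (ε / 2) (by positivity)
  obtain ⟨n₀, hn₀⟩ := Metric.tendsto_atTop.1 hlim (ε / 2) (by positivity)
  refine ⟨n₀, fun n hn => ?_⟩
  have h1 := hn₀ n hn
  have h2 := norm_average_le c (h - g) n (by positivity) hg
  rw [dist_zero_right] at h1 ⊢
  have h3 : average c h n = average c (h - g) n + average c g n := by
    rw [← average_add, sub_add_cancel]
  rw [h3]
  exact (norm_add_le _ _).trans_lt (by linarith)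

/-- With `i` fixed, `|i - j|` takes each value at most once for `j ≤ i` and at most once for `j >
i`. This bounds one row of the double sum that expands the squared norm of an average. -/
lemma sum_natAbs_sub_le (a : ℕ → ℝ) (ha : ∀ l, 0 ≤ a l) (n i : ℕ) (hi : i < n) :
    ∑ j ∈ Finset.range n, a ((i : ℤ) - j).natAbs ≤ 2 * ∑ l ∈ Finset.range n, a l := by
  have h1 : ∑ j ∈ Finset.range n with j ≤ i, a ((i : ℤ) - j).natAbs ≤ ∑ l ∈ Finset.range n, a l := by
    rw [← Finset.sum_image (f := a) (g := fun j : ℕ => ((i : ℤ) - j).natAbs)]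
    · refine Finset.sum_le_sum_of_subset_of_nonneg ?_ (fun l _ _ => ha l)
      intro l hl
      simp only [Finset.mem_image, Finset.mem_filter, Finset.mem_range] at hl ⊢
      omega
    · intro x hx y hy hxy
      simp only [Finset.coe_filter, Set.mem_ofPred_eq, Finset.mem_range] at hx hy hxy
      omega
  have h2 : ∑ j ∈ Finset.range n with ¬ j ≤ i, a ((i : ℤ) - j).natAbs
      ≤ ∑ l ∈ Finset.range n, a l := by
    rw [← Finset.sum_image (f := a) (g := fun j : ℕ => ((i : ℤ) - j).natAbs)]
    · refine Finset.sum_le_sum_of_subset_of_nonneg ?_ (fun l _ _ => ha l)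
      intro l hl
      simp only [Finset.mem_image, Finset.mem_filter, Finset.mem_range] at hl ⊢
      omega
    · intro x hx y hy hxy
      simp only [Finset.coe_filter, Set.mem_ofPred_eq, Finset.mem_range] at hx hy hxy
      omega
  rw [← Finset.sum_filter_add_sum_filter_not (Finset.range n) (fun j => j ≤ i)]
  linarith

end Average

/-- The law of large numbers in a Hilbert space: averages of a sequence whose inner products are
bounded by a null sequence of the lag tend to zero. -/
lemma tendsto_average_of_inner_le {H : Type*} [NormedAddCommGroup H] [InnerProductSpace ℝ H]
    (c : ℤ) (h : ℤ → H) (a : ℕ → ℝ) (ha : Tendsto a atTop (𝓝 0))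
    (hha : ∀ s t, s ≤ t → |inner ℝ (h t) (h s)| ≤ a (t - s).natAbs) :
    Tendsto (average c h) atTop (𝓝 0) := by
  have hha' : ∀ t s, inner ℝ (h t) (h s) ≤ a (t - s).natAbs := by
    intro t s
    rcases le_total s t with hst | hst
    · exact (le_abs_self _).trans (hha s t hst)
    · rw [real_inner_comm, ← neg_sub, Int.natAbs_neg]
      exact (le_abs_self _).trans (hha t s hst)
  have ha0 : ∀ l, 0 ≤ a l := fun l => by
    have := (abs_nonneg _).trans (hha 0 (l : ℤ) (by positivity))
    simpa using this
  have hle : ∀ n : ℕ, ‖average c h n‖ ^ 2 ≤ 2 * ((n : ℝ)⁻¹ * ∑ l ∈ Finset.range n, a l) := by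
    intro n
    rcases Nat.eq_zero_or_pos n with rfl | hn
    · simp [average]
    have hn' : (0 : ℝ) < n := by exact_mod_cast hn
    have h1 : ‖∑ i ∈ Finset.range n, h (c + i)‖ ^ 2
        ≤ n * (2 * ∑ l ∈ Finset.range n, a l) := by
      rw [← real_inner_self_eq_norm_sq, sum_inner]
      calc ∑ i ∈ Finset.range n, inner ℝ (h (c + i)) (∑ j ∈ Finset.range n, h (c + j))
          ≤ ∑ i ∈ Finset.range n, (2 * ∑ l ∈ Finset.range n, a l) := by
            refine Finset.sum_le_sum fun i hi => ?_
            rw [inner_sum]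
            refine le_trans (Finset.sum_le_sum fun j _ => hha' (c + i) (c + j)) ?_
            have := sum_natAbs_sub_le a ha0 n i (Finset.mem_range.1 hi)
            simpa using this
        _ = n * (2 * ∑ l ∈ Finset.range n, a l) := by simp
    rw [average, norm_smul, norm_inv, Real.norm_of_nonneg hn'.le, mul_pow]
    calc ((n : ℝ)⁻¹) ^ 2 * ‖∑ i ∈ Finset.range n, h (c + i)‖ ^ 2
        ≤ ((n : ℝ)⁻¹) ^ 2 * (n * (2 * ∑ l ∈ Finset.range n, a l)) := by gcongr
      _ = 2 * ((n : ℝ)⁻¹ * ∑ l ∈ Finset.range n, a l) := by field_simp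
  -- The bound is twice a Cesàro mean of the null sequence `a`.
  have hlim : Tendsto (fun n : ℕ => 2 * ((n : ℝ)⁻¹ * ∑ l ∈ Finset.range n, a l)) atTop (𝓝 0) := by
    simpa using ha.cesaro.const_mul 2
  have h2 := squeeze_zero (fun n => sq_nonneg _) hle hlim
  rw [tendsto_zero_iff_norm_tendsto_zero]
  have h3 := h2.sqrt
  simpa [Real.sqrt_sq] using h3

/-! ### Strong mixing -/

section Mixing

variable {Ω : Type*} {mΩ : MeasurableSpace Ω} {μ : Measure Ω} [IsProbabilityMeasure μ]

/-- If `Y` has covariance at most `c` with all the events of `m`, then it has covariance at most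
`2 * c * M` with every `m`-measurable variable bounded by `M`. -/
lemma abs_integral_mul_sub_le {m : MeasurableSpace Ω} (hm : m ≤ mΩ) {X Y : Ω → ℝ} {M c : ℝ}
    (hX : Measurable[m] X) (hXM : ∀ ω, |X ω| ≤ M) (hY : Integrable Y μ)
    (hc : ∀ A, MeasurableSet[m] A → |∫ ω in A, Y ω ∂μ - μ.real A * ∫ ω, Y ω ∂μ| ≤ c) :
    |∫ ω, X ω * Y ω ∂μ - (∫ ω, X ω ∂μ) * ∫ ω, Y ω ∂μ| ≤ 2 * c * M := by
  set e := ∫ ω, Y ω ∂μ with he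
  -- Passing to the conditional expectation leaves integrals against bounded `m`-measurable
  -- variables unchanged and puts the sign set of `g` in `m`.
  set g : Ω → ℝ := μ[fun ω => Y ω - e | m] with hg
  have hYe : Integrable (fun ω => Y ω - e) μ := hY.sub (integrable_const _)
  have hgi : Integrable g μ := integrable_condExp
  have hgm : StronglyMeasurable[m] g := stronglyMeasurable_condExp
  have hM : 0 ≤ M := by
    obtain ⟨ω⟩ : Nonempty Ω := μ.nonempty_of_neZero
    exact (abs_nonneg _).trans (hXM ω)
  have hXm : StronglyMeasurable[m] X := hX.stronglyMeasurable
  have hXY : Integrable (fun ω => X ω * Y ω) μ :=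
    hY.bdd_mul (hXm.mono hm).aestronglyMeasurable (ae_of_all _ hXM)
  have hXi : Integrable X μ :=
    (integrable_const M).mono' (hXm.mono hm).aestronglyMeasurable (ae_of_all _ hXM)
  have hXYe : Integrable (X * fun ω => Y ω - e) μ :=
    hYe.bdd_mul (hXm.mono hm).aestronglyMeasurable (ae_of_all _ hXM)
  have h1 : ∫ ω, X ω * Y ω ∂μ - (∫ ω, X ω ∂μ) * e = ∫ ω, X ω * g ω ∂μ := by
    have h2 : ∫ ω, X ω * g ω ∂μ = ∫ ω, (X * fun ω => Y ω - e) ω ∂μ := by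
      rw [← integral_condExp hm (f := X * fun ω => Y ω - e)]
      exact integral_congr_ae (condExp_mul_of_stronglyMeasurable_left hXm hXYe hYe).symm
    rw [h2]
    simp only [Pi.mul_apply, mul_sub]
    rw [integral_sub hXY (hXi.mul_const e), integral_mul_const]
  have hset : ∀ A, MeasurableSet[m] A → |∫ ω in A, g ω ∂μ| ≤ c := by
    intro A hA
    rw [setIntegral_condExp hm hYe hA, integral_sub hY.integrableOn (integrable_const _)]
    simpa [mul_comm] using hc A hA
  have hA : MeasurableSet[m] {ω | 0 ≤ g ω} := measurableSet_le measurable_const hgm.measurable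
  -- The events `{0 ≤ g}` and its complement each contribute at most `c`.
  have h3 : ∫ ω, |g ω| ∂μ ≤ 2 * c := by
    rw [← integral_add_compl (hm _ hA) hgi.abs]
    have h4 : ∫ ω in {ω | 0 ≤ g ω}, |g ω| ∂μ = ∫ ω in {ω | 0 ≤ g ω}, g ω ∂μ :=
      setIntegral_congr_fun (hm _ hA) fun ω hω => abs_of_nonneg hω
    have h5 : ∫ ω in {ω | 0 ≤ g ω}ᶜ, |g ω| ∂μ = ∫ ω in {ω | 0 ≤ g ω}ᶜ, - g ω ∂μ :=
      setIntegral_congr_fun (hm _ hA).compl fun ω hω => abs_of_neg (by simpa using hω)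
    rw [h4, h5, integral_neg]
    have h6 := (abs_le.1 (hset _ hA)).2
    have h7 := (abs_le.1 (hset _ hA.compl)).1
    linarith
  rw [h1]
  calc |∫ ω, X ω * g ω ∂μ| ≤ ∫ ω, |X ω * g ω| ∂μ := abs_integral_le_integral_abs
    _ ≤ ∫ ω, M * |g ω| ∂μ := by
        refine integral_mono_of_nonneg (ae_of_all _ fun _ => abs_nonneg _) (hgi.abs.const_mul M)
          (ae_of_all _ fun ω => ?_)
        simp only [abs_mul]
        exact mul_le_mul_of_nonneg_right (hXM ω) (abs_nonneg _)
    _ = M * ∫ ω, |g ω| ∂μ := integral_const_mul _ _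
    _ ≤ M * (2 * c) := by gcongr
    _ = 2 * c * M := by ring

/-- The covariance inequality for bounded variables under strong mixing. -/
lemma abs_covariance_le_of_mixing {m₁ m₂ : MeasurableSpace Ω} (hm₁ : m₁ ≤ mΩ) (hm₂ : m₂ ≤ mΩ)
    {X Y : Ω → ℝ} {M a : ℝ} (hX : Measurable[m₁] X) (hY : Measurable[m₂] Y)
    (hXM : ∀ ω, |X ω| ≤ M) (hYM : ∀ ω, |Y ω| ≤ M)
    (ha : ∀ A B, MeasurableSet[m₁] A → MeasurableSet[m₂] B →
      |μ.real (A ∩ B) - μ.real A * μ.real B| ≤ a) :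
    |∫ ω, X ω * Y ω ∂μ - (∫ ω, X ω ∂μ) * ∫ ω, Y ω ∂μ| ≤ 4 * a * M ^ 2 := by
  have hYi : Integrable Y μ := (integrable_const M).mono'
    (hY.mono hm₂ le_rfl).aestronglyMeasurable (ae_of_all _ hYM)
  -- The one-sided inequality is used twice, here with `Y` against the indicator of `A`, then with
  -- `X` against `Y`; each use costs a factor `2`.
  have key : ∀ A, MeasurableSet[m₁] A →
      |∫ ω in A, Y ω ∂μ - μ.real A * ∫ ω, Y ω ∂μ| ≤ 2 * a * M := by
    intro A hA
    have hA' := hm₁ _ hA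
    have hind : Integrable (A.indicator (fun _ => (1 : ℝ))) μ :=
      (integrable_const _).indicator hA'
    have := abs_integral_mul_sub_le (μ := μ) hm₂ hY hYM hind (c := a) (by
      intro B hB
      rw [integral_indicator_const _ hA', integral_indicator_const _ hA',
        measureReal_restrict_apply hA']
      simpa [Set.inter_comm, mul_comm] using ha A B hA hB)
    rw [integral_indicator_const _ hA'] at this
    have h2 : ∫ ω, Y ω * A.indicator (fun _ => (1 : ℝ)) ω ∂μ = ∫ ω in A, Y ω ∂μ := by
      rw [← integral_indicator hA']
      congr 1
      ext ω
      by_cases h : ω ∈ A <;> simp [h]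
    rw [h2] at this
    simpa [mul_comm] using this
  have := abs_integral_mul_sub_le (μ := μ) hm₁ hX hXM hYi key
  linarith [this, show 2 * (2 * a * M) * M = 4 * a * M ^ 2 by ring]

end Mixing

section MixingLLN

variable {Ω : Type*} {ι : Type*}

lemma sigmaOf_le [mΩ : MeasurableSpace Ω] {V : ℤ → Ω → ι → ℝ} (hV : ∀ t, Measurable (V t)) (S : Set ℤ) :
    sigmaOf V S ≤ mΩ :=
  iSup₂_le fun s _ => (hV s).comap_le

lemma sigmaOf_mono (V : ℤ → Ω → ι → ℝ) {S S' : Set ℤ} (h : S ⊆ S') :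
    sigmaOf V S ≤ sigmaOf V S' :=
  biSup_mono h

lemma measurable_sigmaOf (V : ℤ → Ω → ι → ℝ) {S : Set ℤ} {s : ℤ} (hs : s ∈ S) (a : ι) :
    Measurable[sigmaOf V S] (fun ω => V s ω a) := by
  have h1 : Measurable[MeasurableSpace.comap (V s) inferInstance] (V s) :=
    comap_measurable (V s)
  have h2 : MeasurableSpace.comap (V s) inferInstance ≤ sigmaOf V S :=
    le_biSup (fun s => MeasurableSpace.comap (V s) inferInstance) hs
  exact (measurable_pi_apply a).comp (h1.mono h2 le_rfl)

variable [mΩ : MeasurableSpace Ω] {μ : Measure Ω} [IsProbabilityMeasure μ]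

lemma le_alphaMix (μ : Measure Ω) [IsProbabilityMeasure μ] (V : ℤ → Ω → ι → ℝ) (l : ℕ) (t : ℤ)
    {A B : Set Ω} (hA : MeasurableSet[sigmaOf V (Set.Iic (t - l))] A)
    (hB : MeasurableSet[sigmaOf V (Set.Ici t)] B) :
    |μ.real (A ∩ B) - μ.real A * μ.real B| ≤ alphaMix μ V l := by
  -- A real `sSup` dominates its set only if the set is bounded above; here `1` is a bound.
  refine le_csSup ⟨1, ?_⟩ ⟨t, A, B, hA, hB, rfl⟩
  rintro r ⟨t, A, B, -, -, rfl⟩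
  have h1 : μ.real (A ∩ B) ≤ 1 := measureReal_le_one
  have h2 : 0 ≤ μ.real (A ∩ B) := measureReal_nonneg
  have h3 : μ.real A ≤ 1 := measureReal_le_one
  have h4 : 0 ≤ μ.real A := measureReal_nonneg
  have h5 : μ.real B ≤ 1 := measureReal_le_one
  have h6 : 0 ≤ μ.real B := measureReal_nonneg
  have h7 := mul_nonneg h4 h6
  have h8 := mul_le_one₀ h3 h6 h5
  rw [abs_le]
  constructor <;> linarith

/-- Truncation of a real number to `[-M, M]`. -/
def trunc (M r : ℝ) : ℝ := max (-M) (min r M)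

lemma abs_trunc_le {M : ℝ} (hM : 0 ≤ M) (r : ℝ) : |trunc M r| ≤ M := by
  rw [trunc, abs_le]
  exact ⟨le_max_left _ _, max_le (by linarith) (min_le_right _ _)⟩

/-- Where truncation acts one has `|r| / M ≥ 1`, so a second-moment bound controls the error in
`L¹`. -/
lemma abs_sub_trunc_le {M : ℝ} (hM : 0 < M) (r : ℝ) : |r - trunc M r| ≤ r ^ 2 / M := by
  rw [le_div_iff₀ hM, trunc]
  rcases le_total r M with h1 | h1
  · rw [min_eq_left h1]
    rcases le_total (-M) r with h2 | h2
    · rw [max_eq_right h2, sub_self, abs_zero, zero_mul]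
      positivity
    · rw [max_eq_left h2, abs_of_nonpos (by linarith)]
      nlinarith
  · rw [min_eq_right h1, max_eq_right (by linarith), abs_of_nonneg (by linarith)]
    nlinarith

lemma measurable_trunc (M : ℝ) : Measurable (trunc M) :=
  measurable_const.max (measurable_id.min measurable_const)

/-- The inclusion of `L²` into `L¹`. -/
def toL1 (μ : Measure Ω) [IsProbabilityMeasure μ] : Lp ℝ 2 μ →L[ℝ] Lp ℝ 1 μ :=
  ((ContinuousLinearMap.mul ℝ ℝ).holderL μ 2 2 1).flip (Lp.const 2 μ 1)

lemma coeFn_toL1 (f : Lp ℝ 2 μ) : toL1 μ f =ᵐ[μ] f := by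
  have h1 : toL1 μ f = (ContinuousLinearMap.mul ℝ ℝ).holder 1 f (Lp.const 2 μ 1) := rfl
  rw [h1]
  filter_upwards [(ContinuousLinearMap.mul ℝ ℝ).coeFn_holder (r := 1) f
    (Lp.const 2 μ (1 : ℝ))] with ω h2
  simp [h2]

/-- Bounded variables generated by a sliding window of a strongly mixing process obey the law of
large numbers in mean square. -/
lemma tendsto_average_of_mixing_bounded {V : ℤ → Ω → ι → ℝ} (hV : ∀ t, Measurable (V t))
    (hα : Tendsto (fun l : ℕ => alphaMix μ V l) atTop (𝓝 0)) {v : ℤ → Ω → ℝ} {w : ℕ} {M : ℝ}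
    (hv : ∀ t, Measurable[sigmaOf V (Set.Icc (t - w) t)] (v t)) (hM : ∀ t ω, |v t ω| ≤ M)
    {g : ℤ → Lp ℝ 2 μ} (hg : ∀ t, g t =ᵐ[μ] fun ω => v t ω - ∫ ω, v t ω ∂μ) (c : ℤ) :
    Tendsto (average c g) atTop (𝓝 0) := by
  have hvm : ∀ t, Measurable (v t) := fun t => (hv t).mono (sigmaOf_le hV _) le_rfl
  have hvi : ∀ t, Integrable (v t) μ := fun t =>
    (integrable_const M).mono' (hvm t).aestronglyMeasurable (ae_of_all _ (hM t))
  have hvv : ∀ t s, Integrable (fun ω => v s ω * v t ω) μ := fun t s =>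
    (hvi t).bdd_mul (hvm s).aestronglyMeasurable (ae_of_all _ (hM s))
  have hinner : ∀ t s, inner ℝ (g t) (g s)
      = ∫ ω, v s ω * v t ω ∂μ - (∫ ω, v s ω ∂μ) * ∫ ω, v t ω ∂μ := by
    intro t s
    rw [L2.inner_def]
    set e := ∫ ω, v t ω ∂μ with he
    set e' := ∫ ω, v s ω ∂μ with he'
    have h1 : ∫ ω, inner ℝ (g t ω) (g s ω) ∂μ
        = ∫ ω, (v s ω * v t ω - v s ω * e) - (e' * v t ω - e' * e) ∂μ := by
      refine integral_congr_ae ?_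
      filter_upwards [hg t, hg s] with ω h1 h2
      simp [h1, h2]
      ring
    have i1 : Integrable (fun ω => v s ω * e) μ := (hvi s).mul_const e
    have i2 : Integrable (fun ω => e' * v t ω) μ := (hvi t).const_mul e'
    have i3 : Integrable (fun ω => v s ω * v t ω - v s ω * e) μ := (hvv t s).sub i1
    have i4 : Integrable (fun ω => e' * v t ω - e' * e) μ := i2.sub (integrable_const _)
    rw [h1, integral_sub i3 i4, integral_sub (hvv t s) i1, integral_sub i2 (integrable_const _),
      integral_mul_const, integral_const_mul]
    simp [← he, ← he']
  have hmean : ∀ t, |∫ ω, v t ω ∂μ| ≤ M := fun t => by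
    have h : ∀ᵐ ω ∂μ, ‖v t ω‖ ≤ M := ae_of_all _ (hM t)
    simpa using norm_integral_le_of_norm_le_const h
  have hM0 : 0 ≤ M := (abs_nonneg _).trans (hmean 0)
  -- At lags `d < w` the two windows overlap and only boundedness helps, but these are finitely many
  -- lags; from `d = w` on, the windows are `d - w` apart and mixing applies.
  refine tendsto_average_of_inner_le c g
    (fun d => if d < w then 4 * M ^ 2 else 4 * alphaMix μ V (d - w) * M ^ 2) ?_ ?_
  · have h1 : Tendsto (fun d => 4 * alphaMix μ V (d - w) * M ^ 2) atTop (𝓝 0) := by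
      simpa using ((hα.comp (tendsto_sub_atTop_nat w)).const_mul 4).mul_const (M ^ 2)
    refine h1.congr' ?_
    filter_upwards [eventually_ge_atTop w] with d hd
    simp [not_lt.2 hd]
  · intro s t hst
    rw [hinner]
    split_ifs with hd
    · have h1 : |∫ ω, v s ω * v t ω ∂μ| ≤ M * M := by
        simpa using norm_integral_le_of_norm_le_const (μ := μ) (C := M * M)
          (f := fun ω => v s ω * v t ω) (ae_of_all _ fun ω => by
            rw [Real.norm_eq_abs, abs_mul]
            exact mul_le_mul (hM s ω) (hM t ω) (abs_nonneg _) hM0)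
      have h2 : |(∫ ω, v s ω ∂μ) * ∫ ω, v t ω ∂μ| ≤ M * M := by
        rw [abs_mul]
        exact mul_le_mul (hmean s) (hmean t) (abs_nonneg _) hM0
      refine (abs_sub _ _).trans ?_
      nlinarith [sq_nonneg M]
    · refine abs_covariance_le_of_mixing (sigmaOf_le hV (Set.Icc (s - w) s))
        (sigmaOf_le hV (Set.Icc (t - w) t)) (hv s) (hv t) (hM s) (hM t) ?_
      intro A B hA hB
      refine le_alphaMix μ V _ (t - w) (sigmaOf_mono V ?_ _ hA) (sigmaOf_mono V ?_ _ hB)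
      · intro r hr
        simp only [Set.mem_Icc, Set.mem_Iic] at hr ⊢
        omega
      · intro r hr
        exact hr.1

/-- The law of large numbers in `L¹` for variables generated by a sliding window of a strongly
mixing process and bounded in `L²`. -/
lemma tendsto_average_of_mixing {V : ℤ → Ω → ι → ℝ} (hV : ∀ t, Measurable (V t))
    (hα : Tendsto (fun l : ℕ => alphaMix μ V l) atTop (𝓝 0)) {v : ℤ → Ω → ℝ} {w : ℕ} {C : ℝ}
    (hv : ∀ t, Measurable[sigmaOf V (Set.Icc (t - w) t)] (v t)) (hv2 : ∀ t, MemLp (v t) 2 μ)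
    (hC : ∀ t, ∫ ω, v t ω ^ 2 ∂μ ≤ C)
    {g : ℤ → Lp ℝ 1 μ} (hg : ∀ t, g t =ᵐ[μ] fun ω => v t ω - ∫ ω, v t ω ∂μ) (c : ℤ) :
    Tendsto (average c g) atTop (𝓝 0) := by
  have hC0 : 0 ≤ C := (integral_nonneg fun ω => sq_nonneg _).trans (hC 0)
  have hvm : ∀ t, Measurable (v t) := fun t => (hv t).mono (sigmaOf_le hV _) le_rfl
  have hvi : ∀ t, Integrable (v t) μ := fun t => (hv2 t).integrable one_le_two
  refine tendsto_average_of_approx c g fun ε hε => ?_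
  -- Truncation at `M` costs at most `C / M` in `L¹`, and as much again for the change of mean.
  obtain ⟨M, hM, hMε⟩ : ∃ M : ℝ, 0 < M ∧ 2 * (C / M) ≤ ε := by
    refine ⟨2 * (C + 1) / ε, by positivity, ?_⟩
    rw [div_div_eq_mul_div, mul_div_assoc', div_le_iff₀ (by positivity)]
    nlinarith
  set T : ℤ → Ω → ℝ := fun t ω => trunc M (v t ω) with hT
  have hTM : ∀ t ω, |T t ω| ≤ M := fun t ω => abs_trunc_le hM.le _
  have hTm : ∀ t, Measurable[sigmaOf V (Set.Icc (t - w) t)] (T t) := fun t =>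
    (measurable_trunc M).comp (hv t)
  have hTm' : ∀ t, Measurable (T t) := fun t => (hTm t).mono (sigmaOf_le hV _) le_rfl
  have hTi : ∀ t, Integrable (T t) μ := fun t =>
    (integrable_const M).mono' (hTm' t).aestronglyMeasurable (ae_of_all _ (hTM t))
  have hT2 : ∀ t, MemLp (fun ω => T t ω - ∫ ω, T t ω ∂μ) 2 μ := fun t =>
    (MemLp.of_bound (hTm' t).aestronglyMeasurable M (ae_of_all _ (hTM t))).sub (memLp_const _)
  refine ⟨fun t => toL1 μ ((hT2 t).toLp _), fun t => ?_, ?_⟩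
  · rw [L1.norm_eq_integral_norm]
    have hd : Integrable (fun ω => v t ω - T t ω) μ := (hvi t).sub (hTi t)
    have h1 : ∀ᵐ ω ∂μ, ‖(g t - toL1 μ ((hT2 t).toLp _)) ω‖
        ≤ |v t ω - T t ω| + ∫ ω, |v t ω - T t ω| ∂μ := by
      filter_upwards [Lp.coeFn_sub (g t) (toL1 μ ((hT2 t).toLp _)), hg t,
        coeFn_toL1 ((hT2 t).toLp _), (hT2 t).coeFn_toLp] with ω h2 h3 h4 h5
      rw [h2, Pi.sub_apply, h3, h4, h5, Real.norm_eq_abs]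
      have h6 : v t ω - ∫ ω, v t ω ∂μ - (T t ω - ∫ ω, T t ω ∂μ)
          = (v t ω - T t ω) - ∫ ω, v t ω - T t ω ∂μ := by
        rw [integral_sub (hvi t) (hTi t)]
        ring
      rw [h6]
      exact (abs_sub _ _).trans (add_le_add le_rfl abs_integral_le_integral_abs)
    have h7 : ∫ ω, |v t ω - T t ω| ∂μ ≤ C / M := by
      calc ∫ ω, |v t ω - T t ω| ∂μ ≤ ∫ ω, v t ω ^ 2 / M ∂μ :=
            integral_mono_of_nonneg (ae_of_all _ fun _ => abs_nonneg _)
              ((hv2 t).integrable_sq.div_const M) (ae_of_all _ fun ω => abs_sub_trunc_le hM _)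
        _ = (∫ ω, v t ω ^ 2 ∂μ) / M := integral_div _ _
        _ ≤ C / M := by gcongr; exact hC t
    have h8 := integral_mono_of_nonneg (ae_of_all _ fun _ => norm_nonneg _)
      (hd.abs.add (integrable_const (∫ ω, |v t ω - T t ω| ∂μ))) h1
    refine h8.trans ?_
    have h9 : ∫ ω, ((fun ω => |v t ω - T t ω|) + fun _ => ∫ ω, |v t ω - T t ω| ∂μ : Ω → ℝ) ω ∂μ
        = ∫ ω, |v t ω - T t ω| ∂μ + ∫ ω, |v t ω - T t ω| ∂μ := by
      rw [integral_add' hd.abs (integrable_const _)]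
      simp
    rw [h9]
    linarith
  · have h1 := tendsto_average_of_mixing_bounded hV hα hTm hTM
      (g := fun t => (hT2 t).toLp _) (fun t => (hT2 t).coeFn_toLp) c
    have h2 := ((toL1 μ).continuous.tendsto 0).comp h1
    rw [map_zero] at h2
    refine h2.congr fun n => ?_
    exact (average_map (toL1 μ) c _ n).symm

end MixingLLN

/-! ### Autoregressions in a Hilbert space -/

section Hilbert

variable {H : Type*} [NormedAddCommGroup H] [InnerProductSpace ℝ H]

/-- Projections onto a decreasing sequence of subspaces with trivial intersection tend to zero. -/
lemma tendsto_starProjection_zero [CompleteSpace H] (U : ℕ → Submodule ℝ H) (hU : Antitone U)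
    [∀ n, (U n).HasOrthogonalProjection] (hbot : ⨅ n, U n = ⊥) (x : H) :
    Tendsto (fun n => (U n).starProjection x) atTop (𝓝 0) := by
  -- The orthogonal complements increase and their union is dense, so the projections onto them tend
  -- to the identity.
  have hmono : Monotone fun n => (U n)ᗮ := fun m n h => Submodule.orthogonal_le (hU h)
  have htop : ⊤ ≤ (⨆ n, (U n)ᗮ).topologicalClosure := by
    rw [← Submodule.orthogonal_orthogonal_eq_closure, ← Submodule.iInf_orthogonal]
    simp only [Submodule.orthogonal_orthogonal, hbot, Submodule.bot_orthogonal_eq_top, le_refl]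
  have h1 := Submodule.starProjection_tendsto_self (fun n => (U n)ᗮ) hmono x htop
  have h2 : (fun n => (U n).starProjection x) = fun n => x - (U n)ᗮ.starProjection x := by
    ext n
    rw [Submodule.starProjection_orthogonal_val]
    abel
  rw [h2]
  simpa using (tendsto_const_nhds (x := x)).sub h1

variable {ι : Type*}

/-- The closed linear span of the components of `z s`, `s ≤ n`. -/
def pastSpan (z : ℤ → ι → H) (n : ℤ) : Submodule ℝ H :=
  (Submodule.span ℝ {f | ∃ s ∈ Set.Iic n, ∃ a : ι, f = z s a}).topologicalClosure

lemma mem_pastSpan (z : ℤ → ι → H) {n s : ℤ} (hs : s ≤ n) (a : ι) : z s a ∈ pastSpan z n :=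
  Submodule.le_topologicalClosure _ (Submodule.subset_span ⟨s, hs, a, rfl⟩)

lemma pastSpan_mono (z : ℤ → ι → H) : Monotone (pastSpan z) := fun _ _ h =>
  Submodule.topologicalClosure_mono (Submodule.span_mono fun _ ⟨s, hs, a, hf⟩ =>
    ⟨s, (Set.mem_Iic.1 hs).trans h, a, hf⟩)

/-- The component `a` of `z`, lagged `j` times. -/
def lagged (z : ℤ → ι → H) (j : ℕ) (a : ι) : ℤ → H := fun t => z (t - j) a

/-- Finite linear combinations of the lags `j < n`. -/
def recentLags (z : ℤ → ι → H) (n : ℕ) : Submodule ℝ (ℤ → H) :=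
  Submodule.span ℝ {f | ∃ j < n, ∃ a, f = lagged z j a}

/-- Finite linear combinations of the lags `j ≥ n`. -/
def remoteLags (z : ℤ → ι → H) (n : ℕ) : Submodule ℝ (ℤ → H) :=
  Submodule.span ℝ {f | ∃ j ≥ n, ∃ a, f = lagged z j a}

/-- Finite linear combinations of lags and of the constant process `o`. -/
def lagsWithConst (z : ℤ → ι → H) (o : H) : Submodule ℝ (ℤ → H) :=
  Submodule.span ℝ ({f | ∃ j a, f = lagged z j a} ∪ {fun _ => o})

lemma lagged_mem_lagsWithConst (z : ℤ → ι → H) (o : H) (j : ℕ) (a : ι) :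
    lagged z j a ∈ lagsWithConst z o := Submodule.subset_span (Or.inl ⟨j, a, rfl⟩)

lemma const_mem_lagsWithConst (z : ℤ → ι → H) (o : H) :
    (fun _ => o) ∈ lagsWithConst z o := Submodule.subset_span (Or.inr rfl)

lemma remoteLags_le_lagsWithConst (z : ℤ → ι → H) (o : H) (n : ℕ) :
    remoteLags z n ≤ lagsWithConst z o := by
  refine Submodule.span_le.2 ?_
  rintro f ⟨j, -, a, rfl⟩
  exact lagged_mem_lagsWithConst z o j a

lemma apply_mem_pastSpan_of_mem_remoteLags {z : ℤ → ι → H} {n : ℕ} {f : ℤ → H}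
    (hf : f ∈ remoteLags z n) (t : ℤ) : f t ∈ pastSpan z (t - n) := by
  induction hf using Submodule.span_induction with
  | mem f hf =>
    obtain ⟨j, hj, a, rfl⟩ := hf
    exact mem_pastSpan z (by omega) a
  | zero => exact Submodule.zero_mem _
  | add f g _ _ h1 h2 => exact Submodule.add_mem _ h1 h2
  | smul c f _ h => exact Submodule.smul_mem _ c h

/-- The second moments of `z` and of the constant `o` do not depend on time. -/
lemma inner_eq_of_mem_lagsWithConst {z : ℤ → ι → H} {o : H}
    (hz : ∀ s t h a b, inner ℝ (z s a) (z (s - h) b) = inner ℝ (z t a) (z (t - h) b))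
    (ho : ∀ t a, inner ℝ (z t a) o = 0) {f g : ℤ → H} (hf : f ∈ lagsWithConst z o)
    (hg : g ∈ lagsWithConst z o) (s t : ℤ) : inner ℝ (f s) (g s) = inner ℝ (f t) (g t) := by
  induction hf, hg using Submodule.span_induction₂ with
  | mem_mem f g hf hg =>
    rcases hf with ⟨i, a, rfl⟩ | rfl <;> rcases hg with ⟨j, b, rfl⟩ | rfl
    · have := hz (s - i) (t - i) (j - i) a b
      simpa [lagged] using this
    · simp [lagged, ho]
    · rw [real_inner_comm, real_inner_comm (lagged z _ _ t)]
      simp [lagged, ho]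
    · rfl
  | zero_left => simp
  | zero_right => simp
  | add_left _ _ _ _ _ _ h1 h2 => simp [inner_add_left, h1, h2]
  | add_right _ _ _ _ _ _ h1 h2 => simp [inner_add_right, h1, h2]
  | smul_left _ _ _ _ _ h => simp [real_inner_smul_left, h]
  | smul_right _ _ _ _ _ h => simp [real_inner_smul_right, h]

/-- All the innovations involved are dated after `t - n`, hence orthogonal to the span of `z` up to
that time. -/
lemma inner_eq_zero_of_mem_recentLags {z e : ℤ → ι → H}
    (he : ∀ t a, ∀ f ∈ pastSpan z (t - 1), inner ℝ f (e t a) = 0) {n : ℕ} {f : ℤ → H}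
    (hf : f ∈ recentLags e n) (t : ℤ) {g : H} (hg : g ∈ pastSpan z (t - n)) :
    inner ℝ g (f t) = 0 := by
  induction hf using Submodule.span_induction with
  | mem f hf =>
    obtain ⟨j, hj, a, rfl⟩ := hf
    exact he _ a g (pastSpan_mono z (by omega) hg)
  | zero => simp
  | add f g _ _ h1 h2 => simp [inner_add_right, h1, h2]
  | smul c f _ h => simp [real_inner_smul_right, h]

variable [Fintype ι] {p : ℕ}

/-- If the best predictor uses only `p` lags, its coefficients do not depend on time. -/
lemma exists_var_coeff {z e : ℤ → ι → H}
    (hz : ∀ s t h a b, inner ℝ (z s a) (z (s - h) b) = inner ℝ (z t a) (z (t - h) b))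
    (he : ∀ t a, ∀ f ∈ pastSpan z (t - 1), inner ℝ f (e t a) = 0)
    (hp : ∀ t a, ∃ c : Fin p → ι → ℝ,
      z t a - e t a = ∑ j : Fin p, ∑ b, c j b • z (t - ((j : ℕ) + 1)) b) :
    ∃ Ψ : Fin p → Matrix ι ι ℝ, ∀ t a,
      z t a = ∑ j : Fin p, ∑ b, Ψ j a b • z (t - ((j : ℕ) + 1)) b + e t a := by
  choose c hc using fun a => hp 0 a
  refine ⟨fun j => Matrix.of fun a b => c a j b, fun t a => ?_⟩
  simp only [Matrix.of_apply]
  obtain ⟨c', hc'⟩ := hp t a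
  set S : ℤ → H := fun t => ∑ j : Fin p, ∑ b, c a j b • z (t - ((j : ℕ) + 1)) b with hS
  -- `d` is the error made at time `t` by the coefficients of time `0`. It is orthogonal to the `p`
  -- lags, since the normal equations involve only second moments (`hS'`), and it lies in their
  -- span, since the true predictor does (`hdd`); so it vanishes.
  set d := z t a - S t - e t a with hd
  have h0 : z 0 a - S 0 = e 0 a := by
    simp only [hS]
    rw [← hc a]
    abel
  have hlag : ∀ (s : ℤ) (j : Fin p) b, inner ℝ (z (s - ((j : ℕ) + 1)) b) (e s a) = 0 :=
    fun s j b => he s a _ (mem_pastSpan z (by omega) b)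
  have hS' : ∀ s (j : Fin p) b, inner ℝ (z (s - ((j : ℕ) + 1)) b) (z s a - S s)
      = inner ℝ (z (0 - ((j : ℕ) + 1)) b) (z 0 a - S 0) := by
    intro s j b
    simp only [hS, inner_sub_right, inner_sum, real_inner_smul_right]
    congr 1
    · have := hz (s - ((j : ℕ) + 1)) (0 - ((j : ℕ) + 1)) (-((j : ℕ) + 1)) b a
      rwa [sub_neg_eq_add, sub_neg_eq_add, sub_add_cancel, sub_add_cancel] at this
    · refine Finset.sum_congr rfl fun i _ => Finset.sum_congr rfl fun b' _ => ?_
      have := hz (s - ((j : ℕ) + 1)) (0 - ((j : ℕ) + 1)) (i - j) b b'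
      have e1 : ∀ r : ℤ, r - ((j : ℕ) + 1) - (i - j) = r - ((i : ℕ) + 1) := fun r => by
        ring
      rw [e1, e1] at this
      rw [this]
  have hlagd : ∀ (j : Fin p) b, inner ℝ (z (t - ((j : ℕ) + 1)) b) d = 0 := by
    intro j b
    rw [hd, inner_sub_right, hS', h0, hlag, hlag, sub_zero]
  have hdd : d = ∑ j : Fin p, ∑ b, (c' j b - c a j b) • z (t - ((j : ℕ) + 1)) b := by
    simp only [sub_smul, Finset.sum_sub_distrib]
    rw [← hc', hd, hS]
    abel
  have hd0 : d = 0 := by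
    rw [← inner_self_eq_zero (𝕜 := ℝ)]
    nth_rewrite 1 [hdd]
    simp only [sum_inner, real_inner_smul_left, hlagd, mul_zero, Finset.sum_const_zero]
  have : z t a = S t + e t a + d := by rw [hd]; abel
  rw [this, hd0, add_zero]

variable {z e : ℤ → ι → H} {Ψ : Fin p → Matrix ι ι ℝ}

/-- The lags of an autoregression with nondegenerate innovations are linearly independent. -/
lemma eq_zero_of_sum_lags_eq_zero
    (he : ∀ t a, ∀ f ∈ pastSpan z (t - 1), inner ℝ f (e t a) = 0)
    (hvar : ∀ t a, z t a = ∑ j : Fin p, ∑ b, Ψ j a b • z (t - ((j : ℕ) + 1)) b + e t a)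
    (hpos : ∀ t (c : ι → ℝ), ∑ a, c a • e t a = 0 → c = 0) {n : ℕ} (t : ℤ) (d : Fin n → ι → ℝ)
    (hd : ∑ j : Fin n, ∑ b, d j b • z (t - (j : ℕ)) b = 0) : d = 0 := by
  induction n generalizing t with
  | zero => exact Subsingleton.elim _ _
  | succ n ih =>
    rw [Fin.sum_univ_succ] at hd
    have h1 : d 0 = 0 := by
      apply hpos t
      set g := ∑ a, d 0 a • e t a with hg
      -- Expanding the lag `0` terms by the autoregression turns the relation into an expression of
      -- `-g` by past variables. But `g` combines innovations at time `t` and is orthogonal to the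
      -- past, hence to itself.
      have hgp : -g ∈ pastSpan z (t - 1) := by
        have h2 : -g = ∑ b, d 0 b • (∑ j : Fin p, ∑ b', Ψ j b b' • z (t - ((j : ℕ) + 1)) b')
            + ∑ j : Fin n, ∑ b, d j.succ b • z (t - ((j.succ : Fin (n + 1)) : ℕ)) b := by
          rw [eq_comm, ← sub_eq_zero, ← hd]
          have : ∑ b, d 0 b • z (t - ((0 : Fin (n + 1)) : ℕ)) b
              = ∑ b, d 0 b • (∑ j : Fin p, ∑ b', Ψ j b b' • z (t - ((j : ℕ) + 1)) b') + g := by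
            rw [hg, ← Finset.sum_add_distrib]
            refine Finset.sum_congr rfl fun b _ => ?_
            rw [← smul_add, ← hvar]
            simp
          rw [this]
          abel
        rw [h2]
        refine Submodule.add_mem _ (Submodule.sum_mem _ fun b _ => Submodule.smul_mem _ _
          (Submodule.sum_mem _ fun j _ => Submodule.sum_mem _ fun b' _ =>
            Submodule.smul_mem _ _ (mem_pastSpan z (by omega) b')))
          (Submodule.sum_mem _ fun j _ => Submodule.sum_mem _ fun b' _ =>
            Submodule.smul_mem _ _ (mem_pastSpan z ?_ b'))
        rw [Fin.val_succ]
        push_cast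
        omega
      rw [← inner_self_eq_zero (𝕜 := ℝ)]
      nth_rewrite 2 [hg]
      rw [inner_sum]
      refine Finset.sum_eq_zero fun a _ => ?_
      have := he t a _ hgp
      rw [inner_neg_left, neg_eq_zero] at this
      rw [real_inner_smul_right, this, mul_zero]
    have h2 : (fun j : Fin n => d j.succ) = 0 := by
      apply ih (t - 1)
      simp only [h1, Pi.zero_apply, zero_smul, Finset.sum_const_zero, zero_add, Fin.val_succ] at hd
      rw [← hd]
      refine Finset.sum_congr rfl fun j _ => Finset.sum_congr rfl fun b _ => ?_
      congr 2
      push_cast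
      ring
    ext j b
    refine Fin.cases ?_ (fun j => ?_) j
    · rw [h1]; rfl
    · exact congrFun (congrFun h2 j) b

/-- The coefficients of an autoregression with nondegenerate innovations are unique. -/
lemma var_coeff_unique
    (he : ∀ t a, ∀ f ∈ pastSpan z (t - 1), inner ℝ f (e t a) = 0)
    (hpos : ∀ t (c : ι → ℝ), ∑ a, c a • e t a = 0 → c = 0) {Ψ' : Fin p → Matrix ι ι ℝ}
    (hvar : ∀ t a, z t a = ∑ j : Fin p, ∑ b, Ψ j a b • z (t - ((j : ℕ) + 1)) b + e t a)
    (hvar' : ∀ t a, z t a = ∑ j : Fin p, ∑ b, Ψ' j a b • z (t - ((j : ℕ) + 1)) b + e t a) :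
    Ψ = Ψ' := by
  ext j a b
  -- Base time `-1` turns the lags `1, …, p` of time `0` into the lags `0, …, p - 1` of the
  -- independence lemma.
  have h := eq_zero_of_sum_lags_eq_zero he hvar hpos (-1) (fun j b => Ψ j a b - Ψ' j a b) (by
    have h1 := (hvar 0 a).symm.trans (hvar' 0 a)
    rw [add_left_inj, ← sub_eq_zero, ← Finset.sum_sub_distrib] at h1
    rw [← h1]
    refine Finset.sum_congr rfl fun j _ => ?_
    rw [← Finset.sum_sub_distrib]
    refine Finset.sum_congr rfl fun b _ => ?_
    rw [sub_smul, show (-1 : ℤ) - (j : ℕ) = 0 - ((j : ℕ) + 1) by ring])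
  exact sub_eq_zero.1 (congrFun (congrFun h j) b)

/-- Each round of the recursion trades the lag `n` of `z` for the innovation at lag `n` and strictly
older lags of `z`. -/
lemma remoteLags_zero_le
    (hvar : ∀ t a, z t a = ∑ j : Fin p, ∑ b, Ψ j a b • z (t - ((j : ℕ) + 1)) b + e t a) (n : ℕ) :
    remoteLags z 0 ≤ recentLags e n ⊔ remoteLags z n := by
  induction n with
  | zero => exact le_sup_right
  | succ n ih =>
    refine ih.trans (sup_le ?_ ?_)
    · refine le_trans (Submodule.span_mono ?_) le_sup_left
      rintro f ⟨j, hj, a, rfl⟩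
      exact ⟨j, by omega, a, rfl⟩
    · refine Submodule.span_le.2 ?_
      rintro f ⟨j, hj, a, rfl⟩
      rcases Nat.eq_or_lt_of_le hj with rfl | hj
      · have h1 : lagged z n a = lagged e n a
            + ∑ j : Fin p, ∑ b, Ψ j a b • lagged z (n + (j + 1)) b := by
          ext t
          simp only [Pi.add_apply, Finset.sum_apply, Pi.smul_apply, lagged]
          rw [hvar, add_comm]
          congr 1
          refine Finset.sum_congr rfl fun j _ => Finset.sum_congr rfl fun b _ => ?_
          congr 2
          push_cast
          ring
        rw [h1]
        refine Submodule.add_mem_sup (Submodule.subset_span ⟨n, by omega, a, rfl⟩)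
          (Submodule.sum_mem _ fun j _ => Submodule.sum_mem _ fun b _ =>
            Submodule.smul_mem _ _ (Submodule.subset_span ⟨_, by omega, b, rfl⟩))
      · exact Submodule.mem_sup_right (Submodule.subset_span ⟨j, hj, a, rfl⟩)

/-- A purely nondeterministic stationary autoregression is a limit, uniformly in time, of finite
moving averages of its innovations. -/
lemma exists_moving_average_approx [CompleteSpace H]
    (hz : ∀ s t h a b, inner ℝ (z s a) (z (s - h) b) = inner ℝ (z t a) (z (t - h) b))
    (he : ∀ t a, ∀ f ∈ pastSpan z (t - 1), inner ℝ f (e t a) = 0)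
    (hvar : ∀ t a, z t a = ∑ j : Fin p, ∑ b, Ψ j a b • z (t - ((j : ℕ) + 1)) b + e t a)
    (hpnd : ⨅ n : ℤ, pastSpan z n = ⊥) {f : ℤ → H} (hf : f ∈ remoteLags z 0) {ε : ℝ}
    (hε : 0 < ε) : ∃ n, ∃ g ∈ recentLags e n, ∀ t, ‖f t - g t‖ ≤ ε := by
  have : ∀ n : ℕ, CompleteSpace (pastSpan z (0 - n)) := fun n =>
    (Submodule.isClosed_topologicalClosure _).completeSpace_coe
  have hbot : ⨅ n : ℕ, pastSpan z (0 - n) = ⊥ := by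
    rw [eq_bot_iff, ← hpnd]
    refine le_iInf fun n => (iInf_le _ n.natAbs).trans (pastSpan_mono z (by omega))
  have hlim := tendsto_starProjection_zero (fun n : ℕ => pastSpan z (0 - n))
    (fun m n h => pastSpan_mono z (by omega)) hbot (f 0)
  obtain ⟨n, hn⟩ := (Metric.tendsto_atTop.1 hlim ε hε)
  have hn := hn n le_rfl
  obtain ⟨g, hg, r, hr, rfl⟩ := Submodule.mem_sup.1 (remoteLags_zero_le hvar n hf)
  refine ⟨n, g, hg, fun t => ?_⟩
  -- `r 0` lies in the past up to `-n` and `g 0` is orthogonal to it, so the remainder is exactly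
  -- the projection of `f 0`.
  have h1 : (pastSpan z (0 - n)).starProjection ((g + r) 0) = r 0 := by
    refine (Submodule.eq_starProjection_of_mem_of_inner_eq_zero
      (apply_mem_pastSpan_of_mem_remoteLags hr 0) fun w hw => ?_)
    rw [Pi.add_apply, add_sub_cancel_right, real_inner_comm]
    exact inner_eq_zero_of_mem_recentLags he hg 0 hw
  rw [h1, dist_zero_right] at hn
  -- Stationarity carries the estimate from time `0` to all times at once.
  have h2 : ‖r t‖ = ‖r 0‖ := by
    have h3 := remoteLags_le_lagsWithConst z 0 n hr
    have h4 := inner_eq_of_mem_lagsWithConst hz (fun _ _ => inner_zero_right _) h3 h3 t 0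
    rw [real_inner_self_eq_norm_sq, real_inner_self_eq_norm_sq] at h4
    exact (sq_eq_sq₀ (norm_nonneg _) (norm_nonneg _)).1 h4
  rw [Pi.add_apply, add_sub_cancel_left, h2]
  exact hn.le

end Hilbert

/-! ### Centred products of square-integrable variables -/

section CentredProduct

variable {Ω : Type*} [mΩ : MeasurableSpace Ω] {μ : Measure Ω}

lemma inner_eq_integral_of_ae {f g : Lp ℝ 2 μ} {v : Ω → ℝ} (hv : ∀ᵐ ω ∂μ, f ω * g ω = v ω) :
    inner ℝ f g = ∫ ω, v ω ∂μ := by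
  rw [L2.inner_def]
  refine integral_congr_ae ?_
  filter_upwards [hv] with ω h
  simp [← h, mul_comm]

variable [IsProbabilityMeasure μ]

/-- The constant variable `1` in `L²`. -/
def oneL2 (μ : Measure Ω) [IsProbabilityMeasure μ] : Lp ℝ 2 μ := Lp.const 2 μ 1

lemma coeFn_oneL2 : oneL2 μ =ᵐ[μ] fun _ => (1 : ℝ) := Lp.coeFn_const 2 μ (1 : ℝ)

/-- The product of two square-integrable variables, minus its mean. -/
def centredMul (f g : Lp ℝ 2 μ) : Lp ℝ 1 μ :=
  (ContinuousLinearMap.mul ℝ ℝ).holder 1 f g - inner ℝ f g • toL1 μ (oneL2 μ)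

lemma coeFn_centredMul (f g : Lp ℝ 2 μ) :
    centredMul f g =ᵐ[μ] fun ω => f ω * g ω - inner ℝ f g := by
  rw [centredMul]
  filter_upwards [Lp.coeFn_sub ((ContinuousLinearMap.mul ℝ ℝ).holder 1 f g)
      (inner ℝ f g • toL1 μ (oneL2 μ)), (ContinuousLinearMap.mul ℝ ℝ).coeFn_holder (r := 1) f g,
    Lp.coeFn_smul (inner ℝ f g) (toL1 μ (oneL2 μ)), coeFn_toL1 (oneL2 μ),
    coeFn_oneL2 (μ := μ)] with ω h1 h2 h3 h4 h5
  rw [h1, Pi.sub_apply, h2, h3, Pi.smul_apply, h4, h5]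
  simp

lemma centredMul_comm (f g : Lp ℝ 2 μ) : centredMul f g = centredMul g f := by
  refine Lp.ext ?_
  filter_upwards [coeFn_centredMul f g, coeFn_centredMul g f] with ω h1 h2
  rw [h1, h2, mul_comm, real_inner_comm]

lemma centredMul_add_left (f f' g : Lp ℝ 2 μ) :
    centredMul (f + f') g = centredMul f g + centredMul f' g := by
  simp only [centredMul, ContinuousLinearMap.holder_add_left, inner_add_left, add_smul]
  abel

lemma centredMul_smul_left (c : ℝ) (f g : Lp ℝ 2 μ) :
    centredMul (c • f) g = c • centredMul f g := by
  simp only [centredMul, ContinuousLinearMap.holder_smul_left, real_inner_smul_left, smul_sub,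
    mul_smul]

lemma norm_centredMul_le (f g : Lp ℝ 2 μ) : ‖centredMul f g‖ ≤ 2 * (‖f‖ * ‖g‖) := by
  have h1 : ‖(ContinuousLinearMap.mul ℝ ℝ).holder 1 f g‖ ≤ ‖f‖ * ‖g‖ := by
    simpa using (ContinuousLinearMap.mul ℝ ℝ).norm_holder_apply_apply_le (r := 1) f g
  have h2 : ‖toL1 μ (oneL2 μ)‖ = 1 := by
    rw [L1.norm_eq_integral_norm]
    have h : (fun ω => ‖toL1 μ (oneL2 μ) ω‖) =ᵐ[μ] fun _ => (1 : ℝ) := by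
      filter_upwards [coeFn_toL1 (oneL2 μ), coeFn_oneL2 (μ := μ)] with ω h1 h2
      rw [h1, h2, norm_one]
    rw [integral_congr_ae h]
    simp
  have h3 : ‖inner ℝ f g • toL1 μ (oneL2 μ)‖ ≤ ‖f‖ * ‖g‖ := by
    rw [norm_smul, h2, mul_one]
    exact norm_inner_le_norm f g
  exact (norm_sub_le _ _).trans (by linarith)

/-- The processes `f` and `g` satisfy the law of large numbers for their products. -/
def ProductLLN (f g : ℤ → Lp ℝ 2 μ) : Prop :=
  ∀ c : ℤ, Tendsto (average c fun t => centredMul (f t) (g t)) atTop (𝓝 0)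

namespace ProductLLN

variable {f f' g : ℤ → Lp ℝ 2 μ}

lemma symm (h : ProductLLN f g) : ProductLLN g f := fun c => by
  simpa only [centredMul_comm] using h c

lemma zero_left : ProductLLN 0 g := fun c => by
  have h : ∀ t, centredMul ((0 : ℤ → Lp ℝ 2 μ) t) (g t) = 0 := fun t => by
    simpa using centredMul_smul_left (0 : ℝ) (0 : Lp ℝ 2 μ) (g t)
  simp only [h]
  refine tendsto_const_nhds.congr fun n => ?_
  simp [average]

lemma add_left (h : ProductLLN f g) (h' : ProductLLN f' g) : ProductLLN (f + f') g := fun c => by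
  have := (h c).add (h' c)
  rw [add_zero] at this
  refine this.congr fun n => ?_
  rw [← average_add]
  congr 1
  ext1 t
  exact (centredMul_add_left _ _ _).symm

lemma smul_left (r : ℝ) (h : ProductLLN f g) : ProductLLN (r • f) g := fun c => by
  have := (h c).const_smul r
  rw [smul_zero] at this
  refine this.congr fun n => ?_
  rw [← average_smul]
  congr 1
  ext1 t
  exact (centredMul_smul_left _ _ _).symm

/-- The centred product has norm at most `2 * ‖f‖ * ‖g‖`, so a uniform `L²` approximation of one
factor is a uniform `L¹` approximation of the product as long as the other factor stays bounded. -/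
lemma of_approx_left {G : ℝ} (hG : ∀ t, ‖g t‖ ≤ G)
    (H : ∀ ε > 0, ∃ f', ProductLLN f' g ∧ ∀ t, ‖f t - f' t‖ ≤ ε) : ProductLLN f g := by
  intro c
  refine tendsto_average_of_approx c _ fun ε hε => ?_
  have hG0 : 0 ≤ G := (norm_nonneg _).trans (hG 0)
  obtain ⟨f', hf', hle⟩ := H (ε / (2 * (G + 1))) (by positivity)
  refine ⟨_, fun t => ?_, hf' c⟩
  have h1 : centredMul (f t) (g t) - centredMul (f' t) (g t) = centredMul (f t - f' t) (g t) := by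
    rw [sub_eq_iff_eq_add, ← centredMul_add_left, sub_add_cancel]
  rw [h1]
  calc ‖centredMul (f t - f' t) (g t)‖ ≤ 2 * (‖f t - f' t‖ * ‖g t‖) := norm_centredMul_le _ _
    _ ≤ 2 * (ε / (2 * (G + 1)) * (G + 1)) := by
        gcongr
        · exact hle t
        · linarith [hG t]
    _ = ε := by field_simp

lemma of_mixing {ι : Type*} {V : ℤ → Ω → ι → ℝ} (hV : ∀ t, Measurable (V t))
    (hα : Tendsto (fun l : ℕ => alphaMix μ V l) atTop (𝓝 0)) {v : ℤ → Ω → ℝ} {w : ℕ} {C : ℝ}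
    (hv : ∀ t, Measurable[sigmaOf V (Set.Icc (t - w) t)] (v t)) (hv2 : ∀ t, MemLp (v t) 2 μ)
    (hC : ∀ t, ∫ ω, v t ω ^ 2 ∂μ ≤ C) (hfg : ∀ t, ∀ᵐ ω ∂μ, f t ω * g t ω = v t ω) :
    ProductLLN f g := fun c => by
  refine tendsto_average_of_mixing hV hα hv hv2 hC (fun t => ?_) c
  filter_upwards [coeFn_centredMul (f t) (g t), hfg t] with ω h1 h2
  rw [h1, h2, inner_eq_integral_of_ae (hfg t)]

end ProductLLN

end CentredProduct

/-! ### Second-order theory in `L²` -/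

section L2

variable {Ω : Type*} [mΩ : MeasurableSpace Ω] {μ : Measure Ω} {ι : Type*}
  {Z : ℤ → Ω → ι → ℝ}

/-- The classes in `L²` of the components of `Z`. -/
def procL2 (μ : Measure Ω) (Z : ℤ → Ω → ι → ℝ) (t : ℤ) (a : ι) : Lp ℝ 2 μ :=
  toL2 μ (fun ω => Z t ω a)

/-- The innovations in `L²`. -/
def innovL2 (μ : Measure Ω) (Z : ℤ → Ω → ι → ℝ) (t : ℤ) (a : ι) : Lp ℝ 2 μ :=
  procL2 μ Z t a - linPred μ Z (Set.Iic (t - 1)) t a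

lemma innov_eq (t : ℤ) (ω : Ω) (a : ι) : innov μ Z t ω a = innovL2 μ Z t a ω := rfl

lemma measurable_innov (t : ℤ) : Measurable (innov μ Z t) :=
  measurable_pi_lambda _ fun a => (Lp.stronglyMeasurable (innovL2 μ Z t a)).measurable

lemma CovStationary.coeFn_procL2 (hS : CovStationary μ Z) (t : ℤ) (a : ι) :
    procL2 μ Z t a =ᵐ[μ] fun ω => Z t ω a := by
  rw [procL2, toL2, dif_pos (hS.memLp t a)]
  exact MemLp.coeFn_toLp _

lemma CovStationary.inner_procL2_one [IsProbabilityMeasure μ] (hS : CovStationary μ Z) (hm : ∀ t a, ∫ ω, Z t ω a ∂μ = 0)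
    (t : ℤ) (a : ι) : inner ℝ (procL2 μ Z t a) (oneL2 μ) = 0 := by
  rw [← hm t a]
  refine inner_eq_integral_of_ae ?_
  filter_upwards [hS.coeFn_procL2 t a, coeFn_oneL2 (μ := μ)] with ω h1 h2
  rw [h1, h2, mul_one]

lemma CovStationary.inner_procL2 (hS : CovStationary μ Z) (hm : ∀ t a, ∫ ω, Z t ω a ∂μ = 0)
    (s t h : ℤ) (a b : ι) : inner ℝ (procL2 μ Z s a) (procL2 μ Z (s - h) b)
      = inner ℝ (procL2 μ Z t a) (procL2 μ Z (t - h) b) := by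
  have key : ∀ s r, inner ℝ (procL2 μ Z s a) (procL2 μ Z r b)
      = ProbabilityTheory.covariance (fun ω => Z s ω a) (fun ω => Z r ω b) μ := by
    intro s r
    rw [ProbabilityTheory.covariance]
    refine inner_eq_integral_of_ae ?_
    filter_upwards [hS.coeFn_procL2 s a, hS.coeFn_procL2 r b] with ω h1 h2
    rw [h1, h2, hm, hm, sub_zero, sub_zero]
  rw [key, key]
  exact hS.cov s t h a b

lemma inner_innovL2_eq_zero (t : ℤ) (a : ι) {f : Lp ℝ 2 μ}
    (hf : f ∈ pastSpan (procL2 μ Z) (t - 1)) : inner ℝ f (innovL2 μ Z t a) = 0 := by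
  have : CompleteSpace (linSpace μ Z (Set.Iic (t - 1))) :=
    (Submodule.isClosed_topologicalClosure _).completeSpace_coe
  rw [real_inner_comm]
  exact Submodule.starProjection_inner_eq_zero _ _ hf

lemma innovCov_apply (t : ℤ) (a b : ι) :
    innovCov μ Z t a b = inner ℝ (innovL2 μ Z t a) (innovL2 μ Z t b) :=
  (inner_eq_integral_of_ae (ae_of_all _ fun _ => rfl)).symm

variable [Fintype ι] {p : ℕ} {Ψ : Fin p → Matrix ι ι ℝ}

lemma FinitePredictor.exists_coeff (hF : FinitePredictor μ Z p) (t : ℤ) (a : ι) :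
    ∃ c : Fin p → ι → ℝ, procL2 μ Z t a - innovL2 μ Z t a
      = ∑ j : Fin p, ∑ b, c j b • procL2 μ Z (t - ((j : ℕ) + 1)) b := by
  have h1 : procL2 μ Z t a - innovL2 μ Z t a = linPred μ Z (Set.Icc (t - p) (t - 1)) t a := by
    rw [← hF t a, innovL2, sub_sub_cancel]
  have h2 : linPred μ Z (Set.Icc (t - p) (t - 1)) t a
      ∈ linSpace μ Z (Set.Icc (t - p) (t - 1)) :=
    Submodule.coe_mem _
  have h3 : {f | ∃ s ∈ Set.Icc (t - p) (t - 1), ∃ b : ι, f = toL2 μ (fun ω => Z s ω b)}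
      = Set.range fun q : Fin p × ι => procL2 μ Z (t - ((q.1 : ℕ) + 1)) q.2 := by
    ext f
    constructor
    · rintro ⟨s, hs, b, rfl⟩
      refine ⟨(⟨(t - 1 - s).toNat, ?_⟩, b), ?_⟩
      · simp only [Set.mem_Icc] at hs
        omega
      · have : t - (((t - 1 - s).toNat : ℤ) + 1) = s := by
          simp only [Set.mem_Icc] at hs
          omega
        simp only [this]
        rfl
    · rintro ⟨⟨j, b⟩, rfl⟩
      refine ⟨_, ?_, b, rfl⟩
      have := j.2
      simp only [Set.mem_Icc]
      omega
  rw [linSpace, h3] at h2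
  -- A finite-dimensional span is closed, so taking the closure adds nothing and the projection is a
  -- genuine finite combination.
  have : FiniteDimensional ℝ (Submodule.span ℝ
      (Set.range fun q : Fin p × ι => procL2 μ Z (t - ((q.1 : ℕ) + 1)) q.2)) :=
    FiniteDimensional.span_of_finite ℝ (Set.finite_range _)
  rw [(Submodule.closed_of_finiteDimensional _).submodule_topologicalClosure_eq,
    Submodule.mem_span_range_iff_exists_fun] at h2
  obtain ⟨c, hc⟩ := h2
  refine ⟨fun j b => c (j, b), ?_⟩
  rw [h1, ← hc, Fintype.sum_prod_type]

/-- The quadratic form `c'Σc` is the squared `L²` norm of the combination with coefficients `c`. -/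
lemma eq_zero_of_innovCov_posDef {t : ℤ} (h : (innovCov μ Z t).PosDef) {c : ι → ℝ}
    (hc : ∑ a, c a • innovL2 μ Z t a = 0) : c = 0 := by
  by_contra hne
  have h1 := h.dotProduct_mulVec_pos hne
  have h2 : star c ⬝ᵥ (innovCov μ Z t).mulVec c
      = inner ℝ (∑ a, c a • innovL2 μ Z t a) (∑ a, c a • innovL2 μ Z t a) := by
    simp only [dotProduct, Matrix.mulVec, innovCov_apply, sum_inner, inner_sum,
      real_inner_smul_left, real_inner_smul_right, Finset.mul_sum, star_trivial]
    refine Finset.sum_congr rfl fun a _ => Finset.sum_congr rfl fun b _ => ?_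
    rw [real_inner_comm (innovL2 μ Z t a)]
    ring
  rw [h2, hc, inner_zero_left] at h1
  exact lt_irrefl _ h1

lemma CovStationary.coeFn_var_rhs (hS : CovStationary μ Z) (Ψ : Fin p → Matrix ι ι ℝ) (t : ℤ) :
    ∀ᵐ ω ∂μ, ∀ a, (∑ j : Fin p, ∑ b, Ψ j a b • procL2 μ Z (t - ((j : ℕ) + 1)) b
      + innovL2 μ Z t a : Lp ℝ 2 μ) ω
      = (∑ j : Fin p, (Ψ j).mulVec (Z (t - ((j : ℕ) + 1)) ω) + innov μ Z t ω) a := by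
  rw [ae_all_iff]
  intro a
  have h1 : ∀ᵐ ω ∂μ, ∀ (j : Fin p) (b : ι),
      procL2 μ Z (t - ((j : ℕ) + 1)) b ω = Z (t - ((j : ℕ) + 1)) ω b := by
    simp only [ae_all_iff]
    exact fun j b => hS.coeFn_procL2 _ b
  have h2 : ∀ᵐ ω ∂μ, ∀ (j : Fin p) (b : ι),
      (Ψ j a b • procL2 μ Z (t - ((j : ℕ) + 1)) b : Lp ℝ 2 μ) ω
        = Ψ j a b * procL2 μ Z (t - ((j : ℕ) + 1)) b ω := by
    simp only [ae_all_iff]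
    exact fun j b => Lp.coeFn_smul _ _
  have h3 : ∀ᵐ ω ∂μ, ∀ (j : Fin p),
      (∑ b, Ψ j a b • procL2 μ Z (t - ((j : ℕ) + 1)) b : Lp ℝ 2 μ) ω
        = ∑ b, (Ψ j a b • procL2 μ Z (t - ((j : ℕ) + 1)) b : Lp ℝ 2 μ) ω := by
    simp only [ae_all_iff]
    intro j
    exact Lp.coeFn_fun_finsetSum _ _
  filter_upwards [h1, h2, h3, Lp.coeFn_add (∑ j : Fin p, ∑ b,
    Ψ j a b • procL2 μ Z (t - ((j : ℕ) + 1)) b) (innovL2 μ Z t a),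
    Lp.coeFn_fun_finsetSum Finset.univ
      fun j : Fin p => ∑ b, Ψ j a b • procL2 μ Z (t - ((j : ℕ) + 1)) b] with ω h1 h2 h3 h4 h5
  rw [h4, Pi.add_apply, h5, Pi.add_apply, innov_eq, Finset.sum_apply]
  simp only [h3, h2, h1, Matrix.mulVec, dotProduct]

lemma CovStationary.isVAR_iff (hS : CovStationary μ Z) :
    IsVAR μ Z p Ψ ↔ ∀ t a, procL2 μ Z t a
      = ∑ j : Fin p, ∑ b, Ψ j a b • procL2 μ Z (t - ((j : ℕ) + 1)) b + innovL2 μ Z t a := by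
  constructor
  · intro h t a
    refine Lp.ext ?_
    filter_upwards [h t, hS.coeFn_var_rhs Ψ t, hS.coeFn_procL2 t a] with ω h1 h2 h3
    rw [h2, h3]
    exact congrFun h1 a
  · intro h t
    have h3 : ∀ᵐ ω ∂μ, ∀ a, procL2 μ Z t a ω = Z t ω a := by
      rw [ae_all_iff]
      exact fun a => hS.coeFn_procL2 t a
    filter_upwards [hS.coeFn_var_rhs Ψ t, h3] with ω h1 h2
    ext a
    rw [← h2 a, h t a]
    exact h1 a

end L2

/-! ### The law of large numbers for second moments -/

section ProcessLLN

variable {Ω : Type*} [mΩ : MeasurableSpace Ω] {μ : Measure Ω} [IsProbabilityMeasure μ] {ι : Type*}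
  {Z : ℤ → Ω → ι → ℝ}

/-- By the autoregression an innovation is a finite combination of variables of mean zero. -/
lemma innovL2_one_of_var [Fintype ι] {p : ℕ} {Ψ : Fin p → Matrix ι ι ℝ} (hS : CovStationary μ Z)
    (hm : ∀ t a, ∫ ω, Z t ω a ∂μ = 0)
    (hvar : ∀ t a, procL2 μ Z t a
      = ∑ j : Fin p, ∑ b, Ψ j a b • procL2 μ Z (t - ((j : ℕ) + 1)) b + innovL2 μ Z t a)
    (t : ℤ) (a : ι) : inner ℝ (innovL2 μ Z t a) (oneL2 μ) = 0 := by
  have h := hS.inner_procL2_one hm t a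
  rw [hvar t a, inner_add_left, sum_inner] at h
  simpa [sum_inner, real_inner_smul_left, hS.inner_procL2_one hm] using h

/-- Through this inclusion, moving averages of innovations inherit stationarity, and so a norm bound
uniform in time. -/
lemma lagsWithConst_innovL2_le [Fintype ι] {p : ℕ} {Ψ : Fin p → Matrix ι ι ℝ}
    (hvar : ∀ t a, procL2 μ Z t a
      = ∑ j : Fin p, ∑ b, Ψ j a b • procL2 μ Z (t - ((j : ℕ) + 1)) b + innovL2 μ Z t a) :
    lagsWithConst (innovL2 μ Z) (oneL2 μ) ≤ lagsWithConst (procL2 μ Z) (oneL2 μ) := by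
  refine Submodule.span_le.2 ?_
  rintro f (⟨j, a, rfl⟩ | rfl)
  · have h1 : lagged (innovL2 μ Z) j a = lagged (procL2 μ Z) j a
        - ∑ i : Fin p, ∑ b, Ψ i a b • lagged (procL2 μ Z) (j + (i + 1)) b := by
      ext1 t
      simp only [Pi.sub_apply, Finset.sum_apply, Pi.smul_apply, lagged]
      rw [hvar, eq_sub_iff_add_eq, add_comm]
      congr 1
      refine Finset.sum_congr rfl fun j _ => Finset.sum_congr rfl fun b _ => ?_
      congr 2
      push_cast
      ring
    rw [h1]
    exact Submodule.sub_mem _ (lagged_mem_lagsWithConst _ _ _ _)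
      (Submodule.sum_mem _ fun i _ => Submodule.sum_mem _ fun b _ => Submodule.smul_mem _ _
        (lagged_mem_lagsWithConst _ _ _ _))
  · exact const_mem_lagsWithConst _ _

lemma pow_four_le_one_add_rpow {δ : ℝ} (hδ : 0 < δ) {r : ℝ} (hr : 0 ≤ r) :
    r ^ 4 ≤ 1 + r ^ (4 + 2 * δ) := by
  have h0 : 0 ≤ r ^ (4 + 2 * δ) := Real.rpow_nonneg hr _
  rcases le_total r 1 with h | h
  · have := pow_le_one₀ (n := 4) hr h
    linarith
  · calc r ^ 4 = r ^ ((4 : ℕ) : ℝ) := (Real.rpow_natCast r 4).symm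
      _ ≤ r ^ (4 + 2 * δ) := Real.rpow_le_rpow_of_exponent_le h (by push_cast; linarith)
      _ ≤ 1 + r ^ (4 + 2 * δ) := by linarith

/-- Fourth moments are what put products of two innovations in `L²`, uniformly in time; they come
from `r ^ 4 ≤ 1 + r ^ (4 + 2 * δ)`. -/
lemma exists_fourth_moment_le [Fintype ι] {δ : ℝ} (hδ : 0 < δ) {C : ℝ≥0}
    (hC : ∀ t, ∫⁻ ω, ‖innov μ Z t ω‖ₑ ^ (4 + 2 * δ) ∂μ ≤ C) (t : ℤ) :
    Integrable (fun ω => ‖innov μ Z t ω‖ ^ 4) μ ∧ ∫ ω, ‖innov μ Z t ω‖ ^ 4 ∂μ ≤ 1 + C := by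
  have hmeas : Measurable (innov μ Z t) := measurable_innov t
  have he : ∀ ω, ENNReal.ofReal (‖innov μ Z t ω‖ ^ 4) ≤ 1 + ‖innov μ Z t ω‖ₑ ^ (4 + 2 * δ) := by
    intro ω
    refine (ENNReal.ofReal_le_ofReal (pow_four_le_one_add_rpow hδ (norm_nonneg _))).trans ?_
    rw [ENNReal.ofReal_add zero_le_one (Real.rpow_nonneg (norm_nonneg _) _), ENNReal.ofReal_one,
      ← ENNReal.ofReal_rpow_of_nonneg (norm_nonneg _) (by positivity), ofReal_norm]
  have hl : ∫⁻ ω, ENNReal.ofReal (‖innov μ Z t ω‖ ^ 4) ∂μ ≤ ENNReal.ofReal (1 + C) := by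
    refine (lintegral_mono he).trans ?_
    rw [lintegral_add_left measurable_const, lintegral_const, measure_univ, mul_one,
      ENNReal.ofReal_add zero_le_one C.coe_nonneg, ENNReal.ofReal_one]
    refine add_le_add le_rfl ((hC t).trans ?_)
    simp
  have hm4 : AEStronglyMeasurable (fun ω => ‖innov μ Z t ω‖ ^ 4) μ :=
    (hmeas.norm.pow_const 4).aestronglyMeasurable
  have hnn : 0 ≤ᵐ[μ] fun ω => ‖innov μ Z t ω‖ ^ 4 := ae_of_all _ fun ω => by positivity
  refine ⟨⟨hm4, ?_⟩, ?_⟩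
  · rw [hasFiniteIntegral_iff_ofReal hnn]
    exact hl.trans_lt ENNReal.ofReal_lt_top
  · rw [integral_eq_lintegral_of_nonneg_ae hnn hm4]
    exact ENNReal.toReal_le_of_le_ofReal (by positivity) hl

variable [Fintype ι] {p : ℕ}

lemma ProductLLN.of_mem_lagsWithConst_innovL2 (h1 : Assumption1 μ Z p)
    {f g : ℤ → Lp ℝ 2 μ} (hf : f ∈ lagsWithConst (innovL2 μ Z) (oneL2 μ))
    (hg : g ∈ lagsWithConst (innovL2 μ Z) (oneL2 μ)) : ProductLLN f g := by
  obtain ⟨δ, hδ, hα, -, C, hC⟩ := h1.mixing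
  have hV : ∀ t, Measurable (innov μ Z t) := measurable_innov
  have hmom := exists_fourth_moment_le hδ hC
  have hsq : ∀ t a ω, innov μ Z t ω a ^ 2 ≤ 1 + ‖innov μ Z t ω‖ ^ 4 := by
    intro t a ω
    have h2 : innov μ Z t ω a ^ 2 ≤ ‖innov μ Z t ω‖ ^ 2 := by
      rw [← sq_abs]
      exact pow_le_pow_left₀ (abs_nonneg _) (norm_le_pi_norm (innov μ Z t ω) a) 2
    nlinarith [sq_nonneg (‖innov μ Z t ω‖ ^ 2 - 1), sq_nonneg (‖innov μ Z t ω‖ ^ 2)]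
  have single : ∀ (j : ℕ) (a : ι),
      ProductLLN (lagged (innovL2 μ Z) j a) fun _ => oneL2 μ := by
    intro j a
    refine ProductLLN.of_mixing hV hα (v := fun t ω => innov μ Z (t - j) ω a) (w := j)
      (C := 1 + (1 + C)) (fun t => measurable_sigmaOf _ (by simp) a) (fun t => Lp.memLp _)
      (fun t => ?_) (fun t => ?_)
    · calc ∫ ω, innov μ Z (t - j) ω a ^ 2 ∂μ ≤ ∫ ω, 1 + ‖innov μ Z (t - j) ω‖ ^ 4 ∂μ :=
            integral_mono_of_nonneg (ae_of_all _ fun _ => sq_nonneg _)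
              ((integrable_const _).add (hmom _).1) (ae_of_all _ fun ω => hsq _ a ω)
        _ = 1 + ∫ ω, ‖innov μ Z (t - j) ω‖ ^ 4 ∂μ := by
            rw [integral_add (integrable_const _) (hmom _).1]
            simp
        _ ≤ 1 + (1 + C) := add_le_add le_rfl (hmom _).2
    · filter_upwards [coeFn_oneL2 (μ := μ)] with ω h2
      rw [h2, mul_one]
      rfl
  induction hf, hg using Submodule.span_induction₂ with
  | mem_mem f g hf hg =>
    rcases hf with ⟨i, a, rfl⟩ | rfl <;> rcases hg with ⟨j, b, rfl⟩ | rfl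
    · have hle : ∀ t ω, (innov μ Z (t - i) ω a * innov μ Z (t - j) ω b) ^ 2
          ≤ ‖innov μ Z (t - i) ω‖ ^ 4 + ‖innov μ Z (t - j) ω‖ ^ 4 := by
        intro t ω
        have h2 : innov μ Z (t - i) ω a ^ 2 ≤ ‖innov μ Z (t - i) ω‖ ^ 2 := by
          rw [← sq_abs]
          exact pow_le_pow_left₀ (abs_nonneg _) (norm_le_pi_norm (innov μ Z (t - i) ω) a) 2
        have h3 : innov μ Z (t - j) ω b ^ 2 ≤ ‖innov μ Z (t - j) ω‖ ^ 2 := by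
          rw [← sq_abs]
          exact pow_le_pow_left₀ (abs_nonneg _) (norm_le_pi_norm (innov μ Z (t - j) ω) b) 2
        have h4 := mul_le_mul h2 h3 (sq_nonneg _) (sq_nonneg _)
        rw [mul_pow]
        nlinarith [sq_nonneg (‖innov μ Z (t - i) ω‖ ^ 2 - ‖innov μ Z (t - j) ω‖ ^ 2),
          sq_nonneg (‖innov μ Z (t - i) ω‖ ^ 2), sq_nonneg (‖innov μ Z (t - j) ω‖ ^ 2)]
      have hint : ∀ t : ℤ, Integrable (fun ω => ‖innov μ Z (t - i) ω‖ ^ 4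
          + ‖innov μ Z (t - j) ω‖ ^ 4) μ := fun t => (hmom _).1.add (hmom _).1
      -- The window of length `max i j` contains both `t - i` and `t - j`.
      have hvm : ∀ t : ℤ, Measurable[sigmaOf (innov μ Z) (Set.Icc (t - (max i j : ℕ)) t)]
          fun ω => innov μ Z (t - i) ω a * innov μ Z (t - j) ω b := fun t =>
        (measurable_sigmaOf _ (Set.mem_Icc.2 (by omega)) a).mul
          (measurable_sigmaOf _ (Set.mem_Icc.2 (by omega)) b)
      refine ProductLLN.of_mixing hV hα
        (v := fun t ω => innov μ Z (t - i) ω a * innov μ Z (t - j) ω b) (w := max i j)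
        (C := (1 + C) + (1 + C)) hvm (fun t => ?_) (fun t => ?_) (fun t => ?_)
      · have hm := ((hvm t).mono (sigmaOf_le hV _) le_rfl).aestronglyMeasurable (μ := μ)
        rw [memLp_two_iff_integrable_sq hm]
        refine (hint t).mono' (hm.pow 2) (ae_of_all _ fun ω => ?_)
        rw [Real.norm_of_nonneg (sq_nonneg _)]
        exact hle t ω
      · calc ∫ ω, (innov μ Z (t - i) ω a * innov μ Z (t - j) ω b) ^ 2 ∂μ
            ≤ ∫ ω, ‖innov μ Z (t - i) ω‖ ^ 4 + ‖innov μ Z (t - j) ω‖ ^ 4 ∂μ :=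
              integral_mono_of_nonneg (ae_of_all _ fun _ => sq_nonneg _) (hint t)
                (ae_of_all _ fun ω => hle t ω)
          _ = ∫ ω, ‖innov μ Z (t - i) ω‖ ^ 4 ∂μ + ∫ ω, ‖innov μ Z (t - j) ω‖ ^ 4 ∂μ :=
              integral_add (hmom _).1 (hmom _).1
          _ ≤ (1 + C) + (1 + C) := add_le_add (hmom _).2 (hmom _).2
      · exact ae_of_all _ fun ω => rfl
    · exact single i a
    · exact (single j b).symm
    · refine ProductLLN.of_mixing hV hα (v := fun _ _ => 1) (w := 0) (C := 1)
        (fun t => measurable_const) (fun t => memLp_const _) (fun t => by simp) (fun t => ?_)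
      filter_upwards [coeFn_oneL2 (μ := μ)] with ω h2
      rw [h2, mul_one]
  | zero_left => exact .zero_left
  | zero_right => exact ProductLLN.zero_left.symm
  | add_left _ _ _ _ _ _ h1 h2 => exact h1.add_left h2
  | add_right _ _ _ _ _ _ h1 h2 => exact (h1.symm.add_left h2.symm).symm
  | smul_left r _ _ _ _ h => exact h.smul_left r
  | smul_right r _ _ _ _ h => exact (h.symm.smul_left r).symm

/-- Under Assumption 1, products of linear combinations of lags of `Z` and of the constant obey the
law of large numbers. -/
lemma ProductLLN.of_mem_lagsWithConst {Ψ : Fin p → Matrix ι ι ℝ} (h1 : Assumption1 μ Z p)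
    (hm : ∀ t a, ∫ ω, Z t ω a ∂μ = 0)
    (hvar : ∀ t a, procL2 μ Z t a
      = ∑ j : Fin p, ∑ b, Ψ j a b • procL2 μ Z (t - ((j : ℕ) + 1)) b + innovL2 μ Z t a)
    {f g : ℤ → Lp ℝ 2 μ} (hf : f ∈ lagsWithConst (procL2 μ Z) (oneL2 μ))
    (hg : g ∈ lagsWithConst (procL2 μ Z) (oneL2 μ)) : ProductLLN f g := by
  have hz := h1.covStationary.inner_procL2 hm
  have ho := h1.covStationary.inner_procL2_one hm
  have hle := lagsWithConst_innovL2_le hvar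
  have hbound : ∀ {f : ℤ → Lp ℝ 2 μ}, f ∈ lagsWithConst (procL2 μ Z) (oneL2 μ) →
      ∀ t, ‖f t‖ ≤ ‖f 0‖ := by
    intro f hf t
    have h4 := inner_eq_of_mem_lagsWithConst hz ho hf hf t 0
    rw [real_inner_self_eq_norm_sq, real_inner_self_eq_norm_sq] at h4
    exact ((sq_eq_sq₀ (norm_nonneg _) (norm_nonneg _)).1 h4).le
  have happrox : ∀ {f : ℤ → Lp ℝ 2 μ}, f ∈ lagsWithConst (procL2 μ Z) (oneL2 μ) → ∀ ε > 0,
      ∃ f' ∈ lagsWithConst (innovL2 μ Z) (oneL2 μ), ∀ t, ‖f t - f' t‖ ≤ ε := by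
    intro f hf ε hε
    rw [lagsWithConst, Submodule.span_union] at hf
    obtain ⟨f₁, hf₁, f₂, hf₂, rfl⟩ := Submodule.mem_sup.1 hf
    have hf₁' : f₁ ∈ remoteLags (procL2 μ Z) 0 := by
      refine Submodule.span_mono ?_ hf₁
      rintro f ⟨j, a, rfl⟩
      exact ⟨j, Nat.zero_le _, a, rfl⟩
    obtain ⟨n, g, hg, hfg⟩ := exists_moving_average_approx hz
      (fun t a f hf => inner_innovL2_eq_zero t a hf) hvar h1.purelyNondet hf₁' hε
    refine ⟨g + f₂, Submodule.add_mem _ (Submodule.span_mono ?_ hg)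
      (Submodule.span_mono Set.subset_union_right hf₂), fun t => ?_⟩
    · rintro f ⟨j, -, a, rfl⟩
      exact Or.inl ⟨j, a, rfl⟩
    · simpa using hfg t
  refine ProductLLN.of_approx_left (hbound hg) fun ε hε => ?_
  obtain ⟨f', hf', hff'⟩ := happrox hf ε hε
  -- The factors are replaced one at a time; in the second replacement the fixed factor is the
  -- moving average `f'`, whose bound comes from `hle`.
  refine ⟨f', ProductLLN.symm (ProductLLN.of_approx_left (hbound (hle hf')) fun ε hε => ?_), hff'⟩
  obtain ⟨g', hg', hgg'⟩ := happrox hg ε hε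
  exact ⟨g', ProductLLN.of_mem_lagsWithConst_innovL2 h1 hg' hf', hgg'⟩

end ProcessLLN

/-! ### Consistency of least squares -/

section LeastSquares

variable {Ω : Type*} [mΩ : MeasurableSpace Ω] {μ : Measure Ω}

/-- A union bound over the finitely many coordinates, in the sup norm. With `U` a preimage under a
map continuous at `x`, this is the continuous mapping theorem for constant limits. -/
lemma tendsto_measure_notMem_of_tendstoInMeasure {σ : Type*} [Fintype σ] {X : ℕ → Ω → σ → ℝ}
    {x : σ → ℝ} (hX : ∀ s, TendstoInMeasure μ (fun n ω => X n ω s) atTop fun _ => x s)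
    {U : Set (σ → ℝ)} (hU : U ∈ 𝓝 x) : Tendsto (fun n => μ {ω | X n ω ∉ U}) atTop (𝓝 0) := by
  obtain ⟨r, hr, hrU⟩ := Metric.mem_nhds_iff.1 hU
  have h1 : Tendsto (fun n => ∑ s, μ {ω | r ≤ dist (X n ω s) (x s)}) atTop (𝓝 0) := by
    have := tendsto_finsetSum Finset.univ fun s _ => tendstoInMeasure_iff_dist.1 (hX s) r hr
    simpa using this
  refine tendsto_of_tendsto_of_tendsto_of_le_of_le tendsto_const_nhds h1 (fun _ => zero_le)
    fun n => ?_
  refine le_trans (measure_mono (t := ⋃ s, {ω | r ≤ dist (X n ω s) (x s)}) ?_)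
    (measure_iUnion_fintype_le μ _)
  intro ω hω
  by_contra hcon
  simp only [Set.mem_iUnion, Set.mem_ofPred_eq, not_exists, not_le] at hcon
  exact hω (hrU ((dist_pi_lt_iff hr).2 hcon))

variable [IsProbabilityMeasure μ]

/-- Sample second moments converge in probability. -/
lemma ProductLLN.tendstoInMeasure {f g : ℤ → Lp ℝ 2 μ} (h : ProductLLN f g) {F G : ℤ → Ω → ℝ}
    {q : ℝ} (hF : ∀ t, f t =ᵐ[μ] F t) (hG : ∀ t, g t =ᵐ[μ] G t)
    (hq : ∀ t, inner ℝ (f t) (g t) = q) (c : ℤ) :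
    TendstoInMeasure μ
      (fun (n : ℕ) ω => (n : ℝ)⁻¹ * ∑ i ∈ Finset.range n, F (c + i) ω * G (c + i) ω) atTop
      fun _ => q := by
  have h0 : TendstoInMeasure μ (fun n => ((average c (fun t => centredMul (f t) (g t)) n :
      Lp ℝ 1 μ) : Ω → ℝ)) atTop ((0 : Lp ℝ 1 μ) : Ω → ℝ) := tendstoInMeasure_of_tendsto_Lp (h c)
  have h1 := tendstoInMeasure_iff_norm.1 h0
  rw [tendstoInMeasure_iff_norm]
  intro ε hε
  refine (h1 ε hε).congr' ?_
  filter_upwards [eventually_gt_atTop 0] with n hn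
  have hn' : (n : ℝ) ≠ 0 := by exact_mod_cast hn.ne'
  refine measure_congr ?_
  have h2 : ∀ᵐ ω ∂μ, ∀ i : ℕ, centredMul (f (c + i)) (g (c + i)) ω
      = F (c + i) ω * G (c + i) ω - q := by
    rw [ae_all_iff]
    intro i
    filter_upwards [coeFn_centredMul (f (c + i)) (g (c + i)), hF (c + i), hG (c + i)]
      with ω h3 h4 h5
    rw [h3, h4, h5, hq]
  filter_upwards [h2, Lp.coeFn_smul (n : ℝ)⁻¹
      (∑ i ∈ Finset.range n, centredMul (f (c + i)) (g (c + i))),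
    Lp.coeFn_fun_finsetSum (Finset.range n) fun i : ℕ => centredMul (f (c + i)) (g (c + i)),
    Lp.coeFn_zero ℝ 1 μ] with ω h2 h3 h4 h5
  refine propext ?_
  change ε ≤ ‖_‖ ↔ ε ≤ ‖_‖
  rw [h5, average, h3, Pi.smul_apply, h4]
  simp only [h2, Finset.sum_sub_distrib, Finset.sum_const, Finset.card_range, Pi.zero_apply,
    sub_zero, smul_eq_mul, nsmul_eq_mul, mul_sub, inv_mul_cancel_left₀ hn']

/-- By Cramer's rule the inverse is `det⁻¹` times the adjugate, which is continuous where the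
determinant is nonzero. -/
lemma continuousAt_inv_mulVec {κ : Type*} [Fintype κ] [DecidableEq κ]
    {v : (κ × κ) ⊕ κ → ℝ} (hv : (Matrix.of fun a b => v (Sum.inl (a, b))).det ≠ 0) :
    ContinuousAt (fun v : (κ × κ) ⊕ κ → ℝ =>
      (Matrix.of fun a b => v (Sum.inl (a, b)))⁻¹.mulVec fun a => v (Sum.inr a)) v := by
  have hA : Continuous fun v : (κ × κ) ⊕ κ → ℝ =>
      (Matrix.of fun a b => v (Sum.inl (a, b)) : Matrix κ κ ℝ) :=
    continuous_matrix fun a b => continuous_apply _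
  have hb : Continuous fun (v : (κ × κ) ⊕ κ → ℝ) (a : κ) => v (Sum.inr a) :=
    continuous_pi fun a => continuous_apply _
  simp only [Matrix.inv_def, Ring.inverse_eq_inv', Matrix.smul_mulVec]
  exact (hA.matrix_det.continuousAt.inv₀ hv).smul
    (hA.matrix_adjugate.matrix_mulVec hb).continuousAt

/-- Least squares is consistent when sample second moments converge to population ones, the
regressors are linearly independent and the regression errors are orthogonal to them. -/
theorem leastSquares_consistent {κ : Type*} [Fintype κ] [DecidableEq κ]
    {W : κ → ℤ → Lp ℝ 2 μ} {Y : ℤ → Lp ℝ 2 μ} {w : ℤ → Ω → κ → ℝ} {y : ℤ → Ω → ℝ} {θ : κ → ℝ}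
    (hWw : ∀ a t, W a t =ᵐ[μ] fun ω => w t ω a) (hYy : ∀ t, Y t =ᵐ[μ] y t)
    (hWW : ∀ a b, ProductLLN (W a) (W b)) (hYW : ∀ a, ProductLLN Y (W a))
    (hWW' : ∀ a b t, inner ℝ (W a t) (W b t) = inner ℝ (W a 0) (W b 0))
    (hYW' : ∀ a t, inner ℝ (Y t) (W a t) = inner ℝ (Y 0) (W a 0))
    (hli : LinearIndependent ℝ fun a => W a 0)
    (hθ : ∀ a, inner ℝ (Y 0 - ∑ b, θ b • W b 0) (W a 0) = 0) (c : ℤ) :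
    Tendsto (fun n : ℕ => μ {ω | ¬ IsUnit ((n : ℝ)⁻¹ • ∑ i ∈ Finset.range n,
      Matrix.vecMulVec (w (c + i) ω) (w (c + i) ω)).det}) atTop (𝓝 0) ∧
    TendstoInMeasure μ (fun (n : ℕ) ω => ((n : ℝ)⁻¹ • ∑ i ∈ Finset.range n,
        Matrix.vecMulVec (w (c + i) ω) (w (c + i) ω))⁻¹.mulVec
      ((n : ℝ)⁻¹ • ∑ i ∈ Finset.range n, y (c + i) ω • w (c + i) ω)) atTop fun _ => θ := by
  set q : (κ × κ) ⊕ κ → ℝ := Sum.elim (fun ab => inner ℝ (W ab.1 0) (W ab.2 0))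
    (fun a => inner ℝ (Y 0) (W a 0)) with hq
  set X : ℕ → Ω → (κ × κ) ⊕ κ → ℝ := fun n ω => Sum.elim
    (fun ab => (n : ℝ)⁻¹ * ∑ i ∈ Finset.range n, w (c + i) ω ab.1 * w (c + i) ω ab.2)
    (fun a => (n : ℝ)⁻¹ * ∑ i ∈ Finset.range n, y (c + i) ω * w (c + i) ω a) with hX
  have hXq : ∀ s, TendstoInMeasure μ (fun n ω => X n ω s) atTop fun _ => q s := by
    rintro (⟨a, b⟩ | a)
    · exact (hWW a b).tendstoInMeasure (fun t => hWw a t) (fun t => hWw b t) (hWW' a b) c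
    · exact (hYW a).tendstoInMeasure hYy (fun t => hWw a t) (hYW' a) c
  have hgram : ∀ (n : ℕ) ω, (n : ℝ)⁻¹ • ∑ i ∈ Finset.range n,
      Matrix.vecMulVec (w (c + i) ω) (w (c + i) ω) = Matrix.of fun a b => X n ω (Sum.inl (a, b)) := by
    intro n ω
    ext a b
    simp [hX, Matrix.sum_apply, Matrix.vecMulVec_apply]
  have hvec : ∀ (n : ℕ) ω, (n : ℝ)⁻¹ • ∑ i ∈ Finset.range n, y (c + i) ω • w (c + i) ω
      = fun a => X n ω (Sum.inr a) := by
    intro n ω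
    ext a
    simp [hX]
  have hQ : (Matrix.of fun a b => q (Sum.inl (a, b))) = Matrix.gram ℝ fun a => W a 0 := rfl
  have hdet : (Matrix.of fun a b => q (Sum.inl (a, b))).det ≠ 0 := by
    rw [hQ]
    exact Matrix.det_gram_ne_zero_iff_linearIndependent.2 hli
  -- The population normal equations: orthogonality of the error makes the cross moments equal to
  -- the Gram matrix applied to `θ`.
  have hb : (fun a => q (Sum.inr a)) = (Matrix.of fun a b => q (Sum.inl (a, b))).mulVec θ := by
    ext a
    have := hθ a
    rw [inner_sub_left, sub_eq_zero, sum_inner] at this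
    simp only [hq, Sum.elim_inr, Sum.elim_inl, this, Matrix.mulVec, dotProduct, Matrix.of_apply]
    refine Finset.sum_congr rfl fun b _ => ?_
    rw [real_inner_smul_left, mul_comm, real_inner_comm]
  simp only [hgram, hvec]
  constructor
  · have hU : {v : (κ × κ) ⊕ κ → ℝ | (Matrix.of fun a b => v (Sum.inl (a, b))).det ≠ 0} ∈ 𝓝 q := by
      refine IsOpen.mem_nhds ?_ hdet
      refine isOpen_ne.preimage (Continuous.matrix_det ?_)
      exact continuous_matrix fun a b => continuous_apply _
    simpa [isUnit_iff_ne_zero] using tendsto_measure_notMem_of_tendstoInMeasure hXq hU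
  · rw [tendstoInMeasure_iff_dist]
    intro ε hε
    have hc := continuousAt_inv_mulVec hdet
    rw [ContinuousAt, hb, Matrix.mulVec_mulVec,
      Matrix.nonsing_inv_mul _ (isUnit_iff_ne_zero.2 hdet), Matrix.one_mulVec] at hc
    have hU := hc (Metric.ball_mem_nhds θ hε)
    simpa using tendsto_measure_notMem_of_tendstoInMeasure hXq hU

end LeastSquares

/-! ### The augmented regression -/

section Sample

variable {Ω : Type*} {N : ℕ} {k : Fin N → ℕ} {p : ℕ} {x : ℤ → Ω → XIdx k → ℝ}

/-- With `T = n + p` the sample has exactly `n` terms, starting at time `p + 1`, and `T - p` becomes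
`n`. -/
lemma sampleGram_eq (y : ℤ → Ω → Fin N → ℝ) (i : Fin N) (n : ℕ) (ω : Ω) :
    sampleGram p y x i (n + p) ω = (n : ℝ)⁻¹ • ∑ r ∈ Finset.range n,
      Matrix.vecMulVec (wVec p y x i ((p + 1 : ℤ) + r) ω) (wVec p y x i ((p + 1 : ℤ) + r) ω) := by
  rw [sampleGram, ← Finset.Ico_succ_right_eq_Icc, Finset.sum_Ico_eq_sum_range]
  have h : Order.succ (n + p) - (p + 1) = n := by
    rw [Order.succ_eq_add_one]
    omega
  rw [h]
  push_cast
  rw [add_sub_cancel_right]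

lemma thetaHat_eq (y : ℤ → Ω → Fin N → ℝ) (i : Fin N) (n : ℕ) (ω : Ω) :
    thetaHat p y x i (n + p) ω = (sampleGram p y x i (n + p) ω)⁻¹.mulVec
      ((n : ℝ)⁻¹ • ∑ r ∈ Finset.range n,
        y ((p + 1 : ℤ) + r) ω i • wVec p y x i ((p + 1 : ℤ) + r) ω) := by
  rw [thetaHat, ← Finset.Ico_succ_right_eq_Icc, Finset.sum_Ico_eq_sum_range]
  have h : Order.succ (n + p) - (p + 1) = n := by
    rw [Order.succ_eq_add_one]
    omega
  rw [h]
  push_cast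
  rw [add_sub_cancel_right]

end Sample

section Regression

variable {Ω : Type*} [mΩ : MeasurableSpace Ω] {μ : Measure Ω} {N : ℕ} {k : Fin N → ℕ} {p : ℕ}

lemma BD.ebd {Z : ℤ → Ω → ZIdx k → ℝ} {Ψ : Fin p → Matrix (ZIdx k) (ZIdx k) ℝ} (h : BD μ Z Ψ) :
    EBD μ Z := h.2.2

lemma GEXOG.ebd {Z : ℤ → Ω → ZIdx k → ℝ} {Ψ : Fin p → Matrix (ZIdx k) (ZIdx k) ℝ}
    (h : GEXOG μ Z Ψ) : EBD μ Z := h.2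

variable [IsProbabilityMeasure μ]
  {α : Fin N → ℝ} {β μx : XIdx k → ℝ} {x : ℤ → Ω → XIdx k → ℝ} {u : ℤ → Ω → Fin N → ℝ}

lemma integral_zbar (hS : CovStationary μ (zbar μx x u)) (hx : ∀ t a, ∫ ω, x t ω a ∂μ = μx a)
    (hu : ∀ t i, ∫ ω, u t ω i ∂μ = 0) (t : ℤ) (a : ZIdx k) : ∫ ω, zbar μx x u t ω a ∂μ = 0 := by
  rcases a with a | i
  · have h1 : Integrable (fun ω => x t ω a - μx a) μ :=
      (hS.memLp t (Sum.inl a)).integrable one_le_two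
    have h2 : Integrable (fun ω => x t ω a) μ := by
      exact (h1.add (integrable_const (μx a))).congr (ae_of_all _ fun ω => by simp)
    change ∫ ω, x t ω a - μx a ∂μ = 0
    rw [integral_sub h2 (integrable_const _), hx]
    simp
  · exact hu t i

section Abstract

variable {H : Type*} [AddCommGroup H] [Module ℝ H] (α β μx) (z : ℤ → ZIdx k → H) (o : H)

/-- The regressors `x_t` in terms of the centred process `z` and the constant `o`. -/
def regX (t : ℤ) (a : XIdx k) : H := z t (Sum.inl a) + μx a • o

/-- The dependent variables `y_t` in terms of the centred process `z` and the constant `o`. -/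
def regY (t : ℤ) (i : Fin N) : H :=
  α i • o + ∑ a : Fin (k i), β ⟨i, a⟩ • regX μx z o t ⟨i, a⟩ + z t (Sum.inr i)

/-- The regressor vector `w_{i,t}` in terms of the centred process `z` and the constant `o`. -/
def regW (p : ℕ) (i : Fin N) (t : ℤ) : WIdx k p i → H :=
  Sum.elim (fun _ => o) <| Sum.elim (fun a => regX μx z o t ⟨i, a⟩) <|
    Sum.elim (fun jl => regY α β μx z o (t - ((jl.1 : ℕ) + 1)) jl.2)
      (fun ja => regX μx z o (t - ((ja.1 : ℕ) + 1)) ja.2)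

variable {α β μx z o}

lemma sum_BMat_smul (f : XIdx k → H) (l : Fin N) :
    ∑ a, BMat β l a • f a = ∑ a : Fin (k l), β ⟨l, a⟩ • f ⟨l, a⟩ := by
  rw [Fintype.sum_sigma, Finset.sum_eq_single l]
  · simp [BMat]
  · intro i _ hi
    simp [BMat, hi]
  · simp

/-- The augmented regression: `y_{i,t} = w_{i,t}' θ_i + ε_{u,i,t}`. -/
lemma regY_eq {e : ℤ → ZIdx k → H} {Ψ : Fin p → Matrix (ZIdx k) (ZIdx k) ℝ}
    (hvar : ∀ t a, z t a = ∑ j : Fin p, ∑ b, Ψ j a b • z (t - ((j : ℕ) + 1)) b + e t a)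
    (t : ℤ) (i : Fin N) : regY α β μx z o t i
      = ∑ b, thetaVec α β μx Ψ i b • regW α β μx z o p i t b + e t (Sum.inr i) := by
  -- `K j` is the constant released when `u` and the centred `x` at lag `j + 1` are rewritten
  -- through `y` and `x`; the intercept is `α i` minus their sum. It is kept opaque so that the
  -- rearrangement treats it as an atom.
  obtain ⟨K, hK⟩ : ∃ K : Fin p → ℝ, ∀ j,
      K j = ∑ l, (Ψ j).toBlocks₂₂ i l * α l + ∑ a, (Ψ j).toBlocks₂₁ i a * μx a :=
    ⟨_, fun _ => rfl⟩
  have hlag : ∀ (j : Fin p), ∑ b, Ψ j (Sum.inr i) b • z (t - ((j : ℕ) + 1)) b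
      = ∑ l, (Ψ j).toBlocks₂₂ i l • regY α β μx z o (t - ((j : ℕ) + 1)) l
        + ∑ a, LambdaMat β Ψ j i a • regX μx z o (t - ((j : ℕ) + 1)) a
        - K j • o := by
    intro j
    rw [hK]
    set s := t - ((j : ℕ) + 1) with hs
    have h1 : ∑ a, LambdaMat β Ψ j i a • regX μx z o s a
        = ∑ a, (Ψ j).toBlocks₂₁ i a • regX μx z o s a
          - ∑ l, (Ψ j).toBlocks₂₂ i l • ∑ a : Fin (k l), β ⟨l, a⟩ • regX μx z o s ⟨l, a⟩ := by
      simp only [LambdaMat, Matrix.sub_apply, sub_smul, Finset.sum_sub_distrib, Matrix.mul_apply,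
        Finset.sum_smul, mul_smul, ← sum_BMat_smul, Finset.smul_sum]
      rw [Finset.sum_comm (s := (Finset.univ : Finset (XIdx k)))]
    have h2 : ∀ l, z s (Sum.inr l) = regY α β μx z o s l - α l • o
        - ∑ a : Fin (k l), β ⟨l, a⟩ • regX μx z o s ⟨l, a⟩ := fun l => by
      rw [regY]
      abel
    have h3 : ∀ a, z s (Sum.inl a) = regX μx z o s a - μx a • o := fun a => by
      rw [regX, add_sub_cancel_right]
    rw [Fintype.sum_sum_type, h1]
    simp only [h2, h3, smul_sub, Finset.sum_sub_distrib, add_smul, Finset.sum_smul, mul_smul]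
    simp only [Matrix.toBlocks₂₂, Matrix.toBlocks₂₁, Matrix.of_apply]
    abel
  have hγ : gammaVec α μx Ψ i = α i - ∑ j, K j := by
    simp only [hK, gammaVec, Pi.sub_apply, Matrix.sub_mulVec, Matrix.one_mulVec, Matrix.sum_mulVec,
      Finset.sum_apply, Finset.sum_add_distrib, Matrix.mulVec, dotProduct]
    ring
  rw [regY, hvar t (Sum.inr i)]
  simp only [hlag]
  simp only [thetaVec, regW, Fintype.sum_sum_type, Sum.elim_inl, Sum.elim_inr, hγ,
    Fintype.sum_prod_type, Finset.univ_unique, Finset.sum_singleton, sub_smul, Finset.sum_smul,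
    Finset.sum_sub_distrib, Finset.sum_add_distrib]
  abel

end Abstract

section Independence

variable {H : Type*} [NormedAddCommGroup H] [InnerProductSpace ℝ H] {z e : ℤ → ZIdx k → H} {o : H}

/-- The regressors of the augmented regression are linearly independent. -/
lemma linearIndependent_regW {Ψ : Fin p → Matrix (ZIdx k) (ZIdx k) ℝ}
    (ho : ∀ t a, inner ℝ (z t a) o = 0) (ho1 : inner ℝ o o = 1)
    (he : ∀ t a, ∀ f ∈ pastSpan z (t - 1), inner ℝ f (e t a) = 0)
    (hvar : ∀ t a, z t a = ∑ j : Fin p, ∑ b, Ψ j a b • z (t - ((j : ℕ) + 1)) b + e t a)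
    (hpos : ∀ t (c : ZIdx k → ℝ), ∑ a, c a • e t a = 0 → c = 0) (i : Fin N) (t : ℤ) :
    LinearIndependent ℝ (regW α β μx z o p i t) := by
  rw [Fintype.linearIndependent_iff]
  intro c hc
  -- `Q` removes the component along the constant: it kills `o` and fixes `z`, so the means and
  -- intercepts drop out of the relation.
  set Q : H →ₗ[ℝ] H := LinearMap.id - (innerₛₗ ℝ o).smulRight o with hQ
  have hQf : ∀ f, Q f = f - inner ℝ o f • o := fun f => by simp [hQ]
  have hQz : ∀ t a, Q (z t a) = z t a := fun t a => by
    rw [hQf, real_inner_comm, ho, zero_smul, sub_zero]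
  have hQo : Q o = 0 := by rw [hQf, ho1, one_smul, sub_self]
  have hQX : ∀ t a, Q (regX μx z o t a) = z t (Sum.inl a) := fun t a => by
    rw [regX, map_add, map_smul, hQz, hQo, smul_zero, add_zero]
  have hQY : ∀ t l, Q (regY α β μx z o t l)
      = ∑ a : Fin (k l), β ⟨l, a⟩ • z t (Sum.inl ⟨l, a⟩) + z t (Sum.inr l) := fun t l => by
    simp only [regY, map_add, map_smul, map_sum, hQX, hQz, hQo, smul_zero, zero_add]
  have hc' := congrArg Q hc
  -- The coefficients of the relation in terms of `z`. At lag `0` only the regressors of equation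
  -- `i` occur, and no `u`. At older lags `y` contributes its own coefficient to `u` and `β` times
  -- it to `x`; this change of variables is triangular, so `d = 0` kills the `y` coefficients first
  -- and then those of lagged `x`.
  set d : Fin (p + 1) → ZIdx k → ℝ := Fin.cons
    (Sum.elim (fun q => if h : q.1 = i then c (Sum.inr (Sum.inl (h ▸ q.2))) else 0) 0)
    (fun j => Sum.elim
      (fun q => c (Sum.inr (Sum.inr (Sum.inr (j, q))))
        + c (Sum.inr (Sum.inr (Sum.inl (j, q.1)))) * β q)
      (fun l => c (Sum.inr (Sum.inr (Sum.inl (j, l)))))) with hd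
  have hd0 : d = 0 := by
    refine eq_zero_of_sum_lags_eq_zero he hvar hpos t d ?_
    rw [← map_zero Q, ← hc', Fin.sum_univ_succ]
    simp only [hd, Fin.cons_zero, Fin.cons_succ, Fintype.sum_sum_type, Sum.elim_inl, Sum.elim_inr,
      Pi.zero_apply, zero_smul, Finset.sum_const_zero, add_zero, map_sum, map_add, map_smul, regW,
      hQo, smul_zero, zero_add, hQX, hQY, Fin.val_zero, Nat.cast_zero, sub_zero, Fin.val_succ,
      Nat.cast_add, Nat.cast_one, Fintype.sum_prod_type]
    congr 1
    · rw [Fintype.sum_sigma, Finset.sum_eq_single i]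
      · simp
      · intro l _ hl
        simp [hl]
      · simp
    · rw [← Finset.sum_add_distrib]
      refine Finset.sum_congr rfl fun j _ => ?_
      simp only [smul_add, add_smul, Finset.sum_add_distrib, mul_smul, Finset.smul_sum]
      rw [Fintype.sum_sigma (f := fun q : XIdx k => c (Sum.inr (Sum.inr (Sum.inl (j, q.1)))) •
        β q • z (t - ((j : ℕ) + 1)) (Sum.inl q))]
      abel
  have hx : ∀ a, c (Sum.inr (Sum.inl a)) = 0 := fun a => by
    simpa [hd] using congrFun (congrFun hd0 0) (Sum.inl ⟨i, a⟩)
  have hy : ∀ j l, c (Sum.inr (Sum.inr (Sum.inl (j, l)))) = 0 := fun j l => by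
    simpa [hd] using congrFun (congrFun hd0 j.succ) (Sum.inr l)
  have hxl : ∀ j a, c (Sum.inr (Sum.inr (Sum.inr (j, a)))) = 0 := fun j a => by
    simpa [hd, hy] using congrFun (congrFun hd0 j.succ) (Sum.inl a)
  have h1 : c (Sum.inl ()) = 0 := by
    have h2 : o ≠ 0 := fun h => by simp [h] at ho1
    have h3 : c (Sum.inl ()) • o = 0 := by
      rw [← hc]
      simp [Fintype.sum_sum_type, hx, hy, hxl, regW]
    exact (smul_eq_zero.1 h3).resolve_right h2
  rintro (_ | a | ⟨j, l⟩ | ⟨j, a⟩)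
  · exact h1
  · exact hx a
  · exact hy j l
  · exact hxl j a

/-- The errors of the augmented regression are orthogonal to its regressors. -/
lemma inner_innovation_regW {Ψ : Fin p → Matrix (ZIdx k) (ZIdx k) ℝ}
    (he : ∀ t a, ∀ f ∈ pastSpan z (t - 1), inner ℝ f (e t a) = 0)
    (heo : ∀ t a, inner ℝ (e t a) o = 0)
    (hvar : ∀ t a, z t a = ∑ j : Fin p, ∑ b, Ψ j a b • z (t - ((j : ℕ) + 1)) b + e t a)
    (t : ℤ) (i : Fin N) (hee : ∀ a, inner ℝ (e t (Sum.inl a)) (e t (Sum.inr i)) = 0)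
    (b : WIdx k p i) : inner ℝ (e t (Sum.inr i)) (regW α β μx z o p i t b) = 0 := by
  have hlag : ∀ (j : Fin p) b, inner ℝ (e t (Sum.inr i)) (z (t - ((j : ℕ) + 1)) b) = 0 :=
    fun j b => by
      rw [real_inner_comm]
      exact he t _ _ (mem_pastSpan z (by omega) b)
  have hlagX : ∀ (j : Fin p) a,
      inner ℝ (e t (Sum.inr i)) (regX μx z o (t - ((j : ℕ) + 1)) a) = 0 := fun j a => by
    rw [regX, inner_add_right, real_inner_smul_right, hlag, heo, mul_zero, add_zero]
  rcases b with _ | a | ⟨j, l⟩ | ⟨j, a⟩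
  · exact heo t _
  · simp only [regW, Sum.elim_inr, Sum.elim_inl]
    -- The current regressor is not in the past: besides lags and a constant it contains `ε_{x,t}`,
    -- and here `Σ_xu = 0` enters through `hee`.
    rw [regX, hvar]
    simp only [inner_add_right, inner_sum, real_inner_smul_right, hlag, heo, mul_zero, add_zero,
      Finset.sum_const_zero, zero_add]
    rw [real_inner_comm, hee]
  · simp only [regW, Sum.elim_inr, Sum.elim_inl, regY, inner_add_right, inner_sum,
      real_inner_smul_right, hlag, hlagX, heo, mul_zero, add_zero, Finset.sum_const_zero]
  · exact hlagX j a

end Independence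

section Realization

variable (α β μx x u)

lemma regX_mem_lagsWithConst {H : Type*} [NormedAddCommGroup H] [InnerProductSpace ℝ H]
    (z : ℤ → ZIdx k → H) (o : H) (j : ℕ) (a : XIdx k) :
    (fun t => regX μx z o (t - j) a) ∈ lagsWithConst z o :=
  Submodule.add_mem _ (lagged_mem_lagsWithConst z o j (Sum.inl a))
    (Submodule.smul_mem _ (μx a) (const_mem_lagsWithConst z o))

lemma regY_mem_lagsWithConst {H : Type*} [NormedAddCommGroup H] [InnerProductSpace ℝ H]
    (z : ℤ → ZIdx k → H) (o : H) (j : ℕ) (l : Fin N) :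
    (fun t => regY α β μx z o (t - j) l) ∈ lagsWithConst z o := by
  have h : (fun t => regY α β μx z o (t - j) l) = α l • (fun _ => o)
      + ∑ a : Fin (k l), β ⟨l, a⟩ • (fun t => regX μx z o (t - j) ⟨l, a⟩)
      + lagged z j (Sum.inr l) := by
    ext1 t
    simp [regY, lagged]
  rw [h]
  exact Submodule.add_mem _ (Submodule.add_mem _
    (Submodule.smul_mem _ _ (const_mem_lagsWithConst z o))
    (Submodule.sum_mem _ fun a _ => Submodule.smul_mem _ _ (regX_mem_lagsWithConst _ z o j _)))
    (lagged_mem_lagsWithConst z o j _)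

lemma regW_mem_lagsWithConst {H : Type*} [NormedAddCommGroup H] [InnerProductSpace ℝ H]
    (z : ℤ → ZIdx k → H) (o : H) (i : Fin N) (b : WIdx k p i) :
    (fun t => regW α β μx z o p i t b) ∈ lagsWithConst z o := by
  rcases b with _ | a | ⟨j, l⟩ | ⟨j, a⟩
  · exact const_mem_lagsWithConst z o
  · simpa [regW] using regX_mem_lagsWithConst μx z o 0 ⟨i, a⟩
  · simpa [regW] using regY_mem_lagsWithConst α β μx z o (j + 1) l
  · simpa [regW] using regX_mem_lagsWithConst μx z o (j + 1) a

variable {μx x u}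

lemma coeFn_regX (hS : CovStationary μ (zbar μx x u)) (t : ℤ) (a : XIdx k) :
    (regX μx (procL2 μ (zbar μx x u)) (oneL2 μ) t a : Lp ℝ 2 μ) =ᵐ[μ] fun ω => x t ω a := by
  rw [regX]
  filter_upwards [Lp.coeFn_add (procL2 μ (zbar μx x u) t (Sum.inl a)) (μx a • oneL2 μ),
    Lp.coeFn_smul (μx a) (oneL2 μ), coeFn_oneL2 (μ := μ), hS.coeFn_procL2 t (Sum.inl a)]
    with ω h1 h2 h3 h4
  rw [h1, Pi.add_apply, h2, Pi.smul_apply, h3, h4]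
  simp [zbar]

lemma coeFn_regY (hS : CovStationary μ (zbar μx x u)) (t : ℤ) (l : Fin N) :
    (regY α β μx (procL2 μ (zbar μx x u)) (oneL2 μ) t l : Lp ℝ 2 μ) =ᵐ[μ] fun ω => yProc α β x u t ω l := by
  rw [regY]
  have h5 : ∀ᵐ ω ∂μ, ∀ a : Fin (k l), (β ⟨l, a⟩ • regX μx (procL2 μ (zbar μx x u)) (oneL2 μ) t
      ⟨l, a⟩ : Lp ℝ 2 μ) ω = x t ω ⟨l, a⟩ * β ⟨l, a⟩ := by
    rw [ae_all_iff]
    intro a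
    filter_upwards [coeFn_regX hS t ⟨l, a⟩, Lp.coeFn_smul (β ⟨l, a⟩)
      (regX μx (procL2 μ (zbar μx x u)) (oneL2 μ) t ⟨l, a⟩)] with ω h1 h2
    rw [h2, Pi.smul_apply, h1, smul_eq_mul, mul_comm]
  filter_upwards [h5, Lp.coeFn_add (α l • oneL2 μ + ∑ a : Fin (k l), β ⟨l, a⟩ •
      regX μx (procL2 μ (zbar μx x u)) (oneL2 μ) t ⟨l, a⟩)
      (procL2 μ (zbar μx x u) t (Sum.inr l)),
    Lp.coeFn_add (α l • oneL2 μ) (∑ a : Fin (k l), β ⟨l, a⟩ •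
      regX μx (procL2 μ (zbar μx x u)) (oneL2 μ) t ⟨l, a⟩),
    Lp.coeFn_smul (α l) (oneL2 μ), coeFn_oneL2 (μ := μ), hS.coeFn_procL2 t (Sum.inr l),
    Lp.coeFn_fun_finsetSum Finset.univ fun a : Fin (k l) => β ⟨l, a⟩ •
      regX μx (procL2 μ (zbar μx x u)) (oneL2 μ) t ⟨l, a⟩] with ω h5 h6 h7 h8 h9 h10 h11
  rw [h6, Pi.add_apply, h7, Pi.add_apply, h8, Pi.smul_apply, h9, h10, h11]
  simp [h5, zbar, yProc]

lemma coeFn_regW (hS : CovStationary μ (zbar μx x u)) (i : Fin N) (b : WIdx k p i) (t : ℤ) :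
    (regW α β μx (procL2 μ (zbar μx x u)) (oneL2 μ) p i t b : Lp ℝ 2 μ)
      =ᵐ[μ] fun ω => wVec p (yProc α β x u) x i t ω b := by
  rcases b with _ | a | ⟨j, l⟩ | ⟨j, a⟩
  · exact coeFn_oneL2
  · exact coeFn_regX hS t ⟨i, a⟩
  · exact coeFn_regY α β hS _ l
  · exact coeFn_regX hS _ a

end Realization

end Regression

end Durbin

end

theorem lemma3 {Ω : Type*} [MeasurableSpace Ω] (μ : Measure Ω) [IsProbabilityMeasure μ]
    {N : ℕ} {k : Fin N → ℕ} (p₀ : ℕ)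
    (α : Fin N → ℝ) (β : Durbin.XIdx k → ℝ) (μx : Durbin.XIdx k → ℝ)
    (x : ℤ → Ω → Durbin.XIdx k → ℝ) (u : ℤ → Ω → Fin N → ℝ)
    (hx : ∀ t a, ∫ ω, x t ω a ∂μ = μx a) (hu : ∀ t i, ∫ ω, u t ω i ∂μ = 0)
    (h1 : Durbin.Assumption1 μ (Durbin.zbar μx x u) p₀)
    (h2 : Durbin.Assumption2 μ x) :
    (∃! Ψ : Fin p₀ → Matrix (Durbin.ZIdx k) (Durbin.ZIdx k) ℝ,
      Durbin.IsVAR μ (Durbin.zbar μx x u) p₀ Ψ) ∧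
    ∀ Ψ : Fin p₀ → Matrix (Durbin.ZIdx k) (Durbin.ZIdx k) ℝ,
      Durbin.IsVAR μ (Durbin.zbar μx x u) p₀ Ψ →
      (Durbin.BD μ (Durbin.zbar μx x u) Ψ ∨ Durbin.GEXOG μ (Durbin.zbar μx x u) Ψ ∨
        Durbin.EBD μ (Durbin.zbar μx x u)) →
      ∀ i : Fin N,
        Tendsto (fun T : ℕ => μ {ω | ¬ IsUnit
          (Durbin.sampleGram p₀ (Durbin.yProc α β x u) x i T ω).det}) atTop (𝓝 0) ∧
        TendstoInMeasure μ
          (fun (T : ℕ) ω => Durbin.thetaHat p₀ (Durbin.yProc α β x u) x i T ω) atTop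
          (fun _ => Durbin.thetaVec α β μx Ψ i) := by
  set Z := Durbin.zbar μx x u with hZ
  have hS := h1.covStationary
  have hm := Durbin.integral_zbar hS hx hu
  have hz := hS.inner_procL2 hm
  have ho := hS.inner_procL2_one hm
  have he : ∀ t a, ∀ f ∈ Durbin.pastSpan (Durbin.procL2 μ Z) (t - 1),
      inner ℝ f (Durbin.innovL2 μ Z t a) = 0 :=
    fun t a f hf => Durbin.inner_innovL2_eq_zero t a hf
  have hpos : ∀ t (c : Durbin.ZIdx k → ℝ), ∑ a, c a • Durbin.innovL2 μ Z t a = 0 → c = 0 :=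
    fun t c hc => Durbin.eq_zero_of_innovCov_posDef (h1.posDef t) hc
  refine ⟨?_, ?_⟩
  · obtain ⟨Ψ, hΨ⟩ := Durbin.exists_var_coeff hz he h1.finitePredictor.exists_coeff
    refine ⟨Ψ, hS.isVAR_iff.2 hΨ, fun Ψ' hΨ' => ?_⟩
    exact Durbin.var_coeff_unique he hpos (hS.isVAR_iff.1 hΨ') hΨ
  · intro Ψ hΨ hcond i
    -- All three conditions contain `Σ_xu = 0`, which is the only part needed.
    have hE : Durbin.EBD μ Z := hcond.elim Durbin.BD.ebd fun h => h.elim Durbin.GEXOG.ebd id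
    have hvar := hS.isVAR_iff.1 hΨ
    have hee : ∀ a, inner ℝ (Durbin.innovL2 μ Z 0 (Sum.inl a))
        (Durbin.innovL2 μ Z 0 (Sum.inr i)) = 0 := fun a => by
      rw [← Durbin.innovCov_apply]
      exact congrFun (congrFun (hE 0) a) i
    have ho1 : inner ℝ (Durbin.oneL2 μ) (Durbin.oneL2 μ) = 1 := by
      rw [Durbin.inner_eq_integral_of_ae (v := fun _ => 1)]
      · simp
      · filter_upwards [Durbin.coeFn_oneL2 (μ := μ)] with ω h
        rw [h, one_mul]
    have hW := Durbin.regW_mem_lagsWithConst (p := p₀) α β μx (Durbin.procL2 μ Z)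
      (Durbin.oneL2 μ) i
    have hY := Durbin.regY_mem_lagsWithConst α β μx (Durbin.procL2 μ Z) (Durbin.oneL2 μ) 0 i
    simp only [Nat.cast_zero, sub_zero] at hY
    have key := Durbin.leastSquares_consistent (θ := Durbin.thetaVec α β μx Ψ i)
      (W := fun b t => Durbin.regW α β μx (Durbin.procL2 μ Z) (Durbin.oneL2 μ) p₀ i t b)
      (Y := fun t => Durbin.regY α β μx (Durbin.procL2 μ Z) (Durbin.oneL2 μ) t i)
      (w := fun t ω => Durbin.wVec p₀ (Durbin.yProc α β x u) x i t ω)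
      (y := fun t ω => Durbin.yProc α β x u t ω i)
      (Durbin.coeFn_regW α β hS i) (fun t => Durbin.coeFn_regY α β hS t i)
      (fun a b => .of_mem_lagsWithConst h1 hm hvar (hW a) (hW b))
      (fun a => .of_mem_lagsWithConst h1 hm hvar hY (hW a))
      (fun a b t => Durbin.inner_eq_of_mem_lagsWithConst hz ho (hW a) (hW b) t 0)
      (fun a t => Durbin.inner_eq_of_mem_lagsWithConst hz ho hY (hW a) t 0)
      (Durbin.linearIndependent_regW ho ho1 he hvar hpos i 0)
      (fun a => by
        rw [Durbin.regY_eq hvar, add_sub_cancel_left]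
        exact Durbin.inner_innovation_regW he (Durbin.innovL2_one_of_var hS hm hvar) hvar 0 i
          hee a)
      (p₀ + 1)
    constructor
    · rw [← tendsto_add_atTop_iff_nat p₀]
      simpa only [Durbin.sampleGram_eq] using key.1
    · intro ε hε
      -- Shifting `T` to `n + p₀` does not affect the limit and turns the estimator into an average
      -- of `n` terms starting at `p₀ + 1`.
      rw [← tendsto_add_atTop_iff_nat p₀]
      simpa only [Durbin.thetaHat_eq, Durbin.sampleGram_eq] using key.2 ε hε
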